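/- **Setting.** A monoid $R$ with group of units $W$ and set of idempotents $E(R)$ is *factorizable* if $R=E(R)W=WE(R)$ and $E(R)$ is a semilattice, i.e. idempotents commute, so that $ef$ is the meet of $e,f\in E(R)$ for the partial order $e\le f\Leftrightarrow ef=fe=e$. A *(generalized) Renner–Coxeter system* $(R,\Lambda,S)$ consists of a factorizable monoid $R$, a set $S\subseteq W$ such that $(W,S)$ is a Coxeter system, and a set $\Lambda\subseteq E(R)$ that is closed under meets and is a transversal of $E(R)$ for the conjugation action of $W$, such that: for all $e\le e'$ in $E(R)$ there are $w\in W$ and $f\le f'$ in $\Lambda$ with $wew^{-1}=f$, $we'w^{-1}=f'$; for $e\le f$ in $\Lambda$ one has $\lambda^*(e)\subseteq\lambda^*(f)$; and for $e\in\Lambda$ the groups $\{w\in W: we=ew\}$ and $\{w\in W: we=ew=e\}$ are standard parabolic subgroups of $W$. Here, for an idempotent $e$, $$\lambda(e)=\{s\in S: se=es\},\quad \lambda_*(e)=\{s\in S: se=es=e\},\quad \lambda^*(e)=\{s\in S: se=es\ne e\},$$ and $W_I$ denotes the subgroup generated by $I\subseteq S$. On $W$, $\le$ is the Bruhat order; ${}^I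 w^J$ is the minimum of $W_IwW_J$; ${}^IW^J$ is the set of all $u\in W$ with $u\le v$ for all $v\in W_IuW_J$; and $W^J={}^{\emptyset}W^J$, ${}^IW={}^IW^{\emptyset}$. *Adherence orders.* If $r=xey$ and $s=afb$ are in left standard form in $(R,\Lambda,S)$ (that is, $e\in\Lambda$, $x\in W^{\lambda_*(e)}$, $y\in{}^{\lambda(e)}W$, and similarly for $s$), then $r\le^+s$ means: $e\le f$ and there is $w\in W_{\lambda^*(f)}W_{\lambda_*(e)}$ with $x\le aw$ and $w^{-1}b\le y$. If $r=yex$ and $s=bfa$ are in right standard form in $(R,\Lambda,S)$ (that is, $e\in\Lambda$, $x\in{}^{\lambda_*(e)}W$, $y\in W^{\lambda(e)}$, and similarly for $s$), then $r\le^-s$ means: $e\le f$ and there is $w\in W_{\lambda_*(e)}W_{\lambda^*(f)}$ with $x\le wa$ and $bw^{-1}\le y$. *Vanilla form.* Let $R$ be finite, let $w_0$ be the longest element of $W$, and put $\Lambda^-=w_0\Lambda w_0$. An expression $r=\sigma_-e_-\sigma_0e_+\sigma_+$ with $\sigma_-,\sigma_0,\sigma_+\in W$ is in vanilla form if $e_+\in\Lambda$,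 $e_-\in\Lambda^-$, $e_-\mathrel{\mathcal J}r\mathrel{\mathcal J}e_+$ (where $p\mathrel{\mathcal J}q\Leftrightarrow RpR=RqR$), $\sigma_+\in{}^{\lambda(e_+)}W$, $\sigma_-\in W^{\lambda(e_-)}$, and $$\sigma_0\in W_{\lambda^*(e_-)}\bigl({}^{\lambda_*(e_-)}w_0^{\lambda_*(e_+)}\bigr)W_{\lambda^*(e_+)}.$$ **Theorem.** Let $(R,\Lambda,S)$ be a Renner–Coxeter system with $R$ finite, and let $r=\sigma_-e_-\sigma_0e_+\sigma_+$ and $s=\tau_-f_-\tau_0f_+\tau_+$ be in vanilla form. Then the following are equivalent: 1. $e_-\le f_-$, $e_+\le f_+$, and there exist $w_-\in W_{\lambda_*(e_-)}W_{\lambda^*(f_-)}$ and $w_+\in W_{\lambda^*(f_+)}W_{\lambda_*(e_+)}$ such that $\tau_-w_-^{-1}\le\sigma_-$, $\sigma_0\le w_-\tau_0w_+$ and $w_+^{-1}\tau_+\le\sigma_+$; 2. $r\le^+s$ in $(R,\Lambda,S)$; 3. $r\le^-s$ in $(R,\Lambda^-,S)$. -/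

import Mathlib

open scoped Pointwise

/-! ### Coxeter systems: Bruhat order, parabolic subgroups, minimal coset representatives -/

namespace CoxeterSystem

variable {B W : Type*} [Group W] {M : CoxeterMatrix B} (cs : CoxeterSystem M W)

/-- The Bruhat order: some reduced word of `v` has a subword which is a reduced word of `u`. -/
def bruhatLE (u v : W) : Prop :=
  ∃ ω ω' : List B, cs.IsReduced ω ∧ cs.wordProd ω = v ∧
    cs.IsReduced ω' ∧ cs.wordProd ω' = u ∧ ω'.Sublist ω

/-- The standard parabolic subgroup `W_I`, generated by the simple reflections with index
in `I`. -/
def parabolic (I : Set B) : Subgroup W := Subgroup.closure (cs.simple '' I)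

/-- The longest element `w₀` of a finite Coxeter group, i.e. the element of maximal length. -/
noncomputable def longest [Finite W] : W := (Finite.exists_max cs.length).choose

theorem length_le_longest [Finite W] (w : W) : cs.length w ≤ cs.length cs.longest :=
  (Finite.exists_max cs.length).choose_spec w

/-- `m = ᴵwᴶ`, i.e. `m` is the minimum of `W_I w W_J` for the Bruhat order. -/
def IsMinRep (I J : Set B) (w m : W) : Prop :=
  m ∈ DoubleCoset.doubleCoset w (cs.parabolic I : Set W) (cs.parabolic J : Set W) ∧
    ∀ v ∈ DoubleCoset.doubleCoset w (cs.parabolic I : Set W) (cs.parabolic J : Set W),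
      cs.bruhatLE m v

/-- The set `ᴵWᴶ` of minimal double coset representatives. -/
def minReps (I J : Set B) : Set W :=
  {u | ∀ v ∈ DoubleCoset.doubleCoset u (cs.parabolic I : Set W) (cs.parabolic J : Set W),
    cs.bruhatLE u v}

end CoxeterSystem

/-! ### Factorizable monoids and Renner-Coxeter systems -/

namespace RennerCoxeter

variable {R : Type*} [Monoid R]

/-- The partial order on idempotents: `e ≤ f` iff `ef = fe = e`. -/
def idemLE (e f : R) : Prop := e * f = e ∧ f * e = e

/-- A factorizable monoid: it is unit regular (`R = E(R) W = W E(R)`, with `W` the group of units)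
and its idempotents form a semilattice, i.e. they commute, so that `e * f` is the meet of `e`
and `f`. -/
structure IsFactorizable (R : Type*) [Monoid R] : Prop where
  eq_idem_mul_unit : ∀ r : R, ∃ (e : R) (w : Rˣ), IsIdempotentElem e ∧ r = e * w
  eq_unit_mul_idem : ∀ r : R, ∃ (w : Rˣ) (e : R), IsIdempotentElem e ∧ r = w * e
  idem_comm : ∀ e f : R, IsIdempotentElem e → IsIdempotentElem f → e * f = f * e

/-- In a factorizable monoid the product of two idempotents is an idempotent, and is their meet. -/
theorem IsFactorizable.mul_isMeet (hR : IsFactorizable R) {e f : R} (he : IsIdempotentElem e)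
    (hf : IsIdempotentElem f) :
    IsIdempotentElem (e * f) ∧ idemLE (e * f) e ∧ idemLE (e * f) f ∧
      ∀ g, IsIdempotentElem g → idemLE g e → idemLE g f → idemLE g (e * f) := by
  have h := hR.idem_comm e f he hf
  refine ⟨he.mul_of_commute h hf, ⟨?_, ?_⟩, ⟨?_, ?_⟩, ?_⟩
  · rw [h, mul_assoc, he.eq]
  · rw [← mul_assoc, he.eq]
  · rw [mul_assoc, hf.eq]
  · rw [h, ← mul_assoc, hf.eq]
  · rintro g - ⟨h1, h2⟩ ⟨h3, h4⟩
    exact ⟨by rw [← mul_assoc, h1, h3], by rw [mul_assoc, h4, h2]⟩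

/-- Green's relation `𝒥`: `R r R = R s R`. -/
def greenJ (r s : R) : Prop :=
  {x : R | ∃ a b : R, x = a * r * b} = {x : R | ∃ a b : R, x = a * s * b}

variable {B : Type*} {M : CoxeterMatrix B} (cs : CoxeterSystem M Rˣ)

/-- The type map `λ(e) = {s ∈ S | se = es}` (generators are referred to by their indices). -/
def typeMap (e : R) : Set B := {i | (cs.simple i : R) * e = e * (cs.simple i : R)}

/-- The lower type map `λ_*(e) = {s ∈ S | se = es = e}`. -/
def lowerType (e : R) : Set B :=
  {i | (cs.simple i : R) * e = e * (cs.simple i : R) ∧ e * (cs.simple i : R) = e}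

/-- The upper type map `λ^*(e) = {s ∈ S | se = es ≠ e}`. -/
def upperType (e : R) : Set B :=
  {i | (cs.simple i : R) * e = e * (cs.simple i : R) ∧ e * (cs.simple i : R) ≠ e}

/-- `(R, Λ, S)` is a (generalized) Renner-Coxeter system, where `S` is the set of simple reflections
of the Coxeter system `cs` on the group of units of `R`. -/
structure IsRennerCoxeterSystem (Λ : Set R) : Prop where
  factorizable : IsFactorizable R
  idem : ∀ e ∈ Λ, IsIdempotentElem e
  transversal : ∀ e : R, IsIdempotentElem e →
    ∃! f : R, f ∈ Λ ∧ ∃ w : Rˣ, (w : R) * e * ((w⁻¹ : Rˣ) : R) = f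
  mul_mem : ∀ e ∈ Λ, ∀ f ∈ Λ, e * f ∈ Λ
  exists_conj_pair : ∀ e e' : R, IsIdempotentElem e → IsIdempotentElem e' → idemLE e e' →
    ∃ w : Rˣ, ∃ f ∈ Λ, ∃ f' ∈ Λ, idemLE f f' ∧
      (w : R) * e * ((w⁻¹ : Rˣ) : R) = f ∧ (w : R) * e' * ((w⁻¹ : Rˣ) : R) = f'
  upperType_mono : ∀ e ∈ Λ, ∀ f ∈ Λ, idemLE e f → upperType cs e ⊆ upperType cs f
  centralizer_parabolic : ∀ e ∈ Λ, ∃ I : Set B,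
    {w : Rˣ | (w : R) * e = e * (w : R)} = (cs.parabolic I : Set Rˣ)
  fixer_parabolic : ∀ e ∈ Λ, ∃ I : Set B,
    {w : Rˣ | (w : R) * e = e * (w : R) ∧ e * (w : R) = e} = (cs.parabolic I : Set Rˣ)

/-- The standard parabolic subgroup `{w | we = ew}` is `W_{λ(e)}`. -/
theorem IsRennerCoxeterSystem.centralizer_eq {Λ : Set R} (h : IsRennerCoxeterSystem cs Λ)
    {e : R} (he : e ∈ Λ) :
    {w : Rˣ | (w : R) * e = e * (w : R)} = (cs.parabolic (typeMap cs e) : Set Rˣ) := by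
  obtain ⟨I, hI⟩ := h.centralizer_parabolic e he
  refine hI.trans (SetLike.coe_set_eq.2 (le_antisymm ?_ ?_))
  · refine Subgroup.closure_mono (Set.image_mono fun i hi ↦ ?_)
    have : cs.simple i ∈ (cs.parabolic I : Set Rˣ) :=
      Subgroup.subset_closure (Set.mem_image_of_mem _ hi)
    rw [← hI] at this
    exact this
  · refine (Subgroup.closure_le _).2 ?_
    rw [← hI]
    rintro _ ⟨i, hi, rfl⟩
    exact hi

/-- The standard parabolic subgroup `{w | we = ew = e}` is `W_{λ_*(e)}`. -/
theorem IsRennerCoxeterSystem.fixer_eq {Λ : Set R} (h : IsRennerCoxeterSystem cs Λ)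
    {e : R} (he : e ∈ Λ) :
    {w : Rˣ | (w : R) * e = e * (w : R) ∧ e * (w : R) = e} =
      (cs.parabolic (lowerType cs e) : Set Rˣ) := by
  obtain ⟨I, hI⟩ := h.fixer_parabolic e he
  refine hI.trans (SetLike.coe_set_eq.2 (le_antisymm ?_ ?_))
  · refine Subgroup.closure_mono (Set.image_mono fun i hi ↦ ?_)
    have : cs.simple i ∈ (cs.parabolic I : Set Rˣ) :=
      Subgroup.subset_closure (Set.mem_image_of_mem _ hi)
    rw [← hI] at this
    exact this
  · refine (Subgroup.closure_le _).2 ?_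
    rw [← hI]
    rintro _ ⟨i, hi, rfl⟩
    exact hi

/-! ### Standard forms and the Adherence orders -/

/-- `r = x e y` is in left standard form in `(R, Λ, S)`. -/
structure IsLeftStandard (Λ : Set R) (r : R) (x : Rˣ) (e : R) (y : Rˣ) : Prop where
  eq : r = (x : R) * e * (y : R)
  mem : e ∈ Λ
  left_mem : x ∈ cs.minReps ∅ (lowerType cs e)
  right_mem : y ∈ cs.minReps (typeMap cs e) ∅

/-- `r = y e x` is in right standard form in `(R, Λ, S)`. -/
structure IsRightStandard (Λ : Set R) (r : R) (y : Rˣ) (e : R) (x : Rˣ) : Prop where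
  eq : r = (y : R) * e * (x : R)
  mem : e ∈ Λ
  right_mem : x ∈ cs.minReps (lowerType cs e) ∅
  left_mem : y ∈ cs.minReps ∅ (typeMap cs e)

/-- The Adherence order `r ≤⁺ s` in `(R, Λ, S)`, read off from the left standard forms
`r = x e y` and `s = a f b`. -/
def adherencePlus (Λ : Set R) (r s : R) : Prop :=
  ∃ (x : Rˣ) (e : R) (y : Rˣ) (a : Rˣ) (f : R) (b : Rˣ),
    IsLeftStandard cs Λ r x e y ∧ IsLeftStandard cs Λ s a f b ∧ idemLE e f ∧
      ∃ w ∈ (cs.parabolic (upperType cs f) : Set Rˣ) * (cs.parabolic (lowerType cs e) : Set Rˣ),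
        cs.bruhatLE x (a * w) ∧ cs.bruhatLE (w⁻¹ * b) y

/-- The Adherence order `r ≤⁻ s` in `(R, Λ, S)`, read off from the right standard forms
`r = y e x` and `s = b f a`. -/
def adherenceMinus (Λ : Set R) (r s : R) : Prop :=
  ∃ (y : Rˣ) (e : R) (x : Rˣ) (b : Rˣ) (f : R) (a : Rˣ),
    IsRightStandard cs Λ r y e x ∧ IsRightStandard cs Λ s b f a ∧ idemLE e f ∧
      ∃ w ∈ (cs.parabolic (lowerType cs e) : Set Rˣ) * (cs.parabolic (upperType cs f) : Set Rˣ),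
        cs.bruhatLE x (w * a) ∧ cs.bruhatLE (b * w⁻¹) y

/-! ### The finite case: opposite cross-sectional lattice and vanilla form -/

/-- The opposite cross-sectional lattice `Λ⁻ = w₀ Λ w₀`. -/
noncomputable def opposite [Finite Rˣ] (Λ : Set R) : Set R :=
  (fun e : R ↦ (cs.longest : R) * e * (cs.longest : R)) '' Λ

/-- `r = σ₋ e₋ σ₀ e₊ σ₊` is in vanilla form (with respect to `(R, Λ, S)`). -/
structure IsVanilla [Finite Rˣ] (Λ : Set R) (r : R)
    (σm : Rˣ) (em : R) (σ0 : Rˣ) (ep : R) (σp : Rˣ) : Prop where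
  eq : r = (σm : R) * em * (σ0 : R) * ep * (σp : R)
  plus_mem : ep ∈ Λ
  minus_mem : em ∈ opposite cs Λ
  minus_greenJ : greenJ em r
  greenJ_plus : greenJ r ep
  right_mem : σp ∈ cs.minReps (typeMap cs ep) ∅
  left_mem : σm ∈ cs.minReps ∅ (typeMap cs em)
  middle_mem : ∃ m : Rˣ, cs.IsMinRep (lowerType cs em) (lowerType cs ep) cs.longest m ∧
    σ0 ∈ (cs.parabolic (upperType cs em) : Set Rˣ) * {m} *
      (cs.parabolic (upperType cs ep) : Set Rˣ)

end RennerCoxeter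

/-!
The argument has a part about Coxeter groups and a part about idempotents, and the two meet in the
description of vanilla forms.

*Coxeter groups.* Since `cs.bruhatLE u v` mentions some reduced word of `v`, one first needs that
every reduced word of `v` has a subword for `u`. This follows from the strong exchange property
(`CoxeterSystem.exists_eraseIdx_of_isRightInversion`, proved through the action of `W` on
`W × ZMod 2` by signed conjugation) and the lifting property, which identify the Bruhat order with
the order generated by `u < u t` for reflections `t` with `ℓ(u) < ℓ(u t)`
(`CoxeterSystem.bruhatLE_iff_reflTransGen`). Two consequences carry the theorem. If
`ℓ(a b) = ℓ(a) + ℓ(b)`, then the elements below `a b` are the products of an element below `a` and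
one below `b` (`CoxeterSystem.bruhatLE_mul_iff`). Right multiplication by the longest element `w₀`
reverses the order (`CoxeterSystem.mul_longest_bruhatLE_mul_longest_iff`).

*Idempotents.* Idempotents of `R` that are `𝒥`-equivalent are conjugate, so `e₋ = w₀ e₊ w₀`, and the
set `w₀ Λ w₀` is again the cross-sectional lattice of a Renner-Coxeter system
(`RennerCoxeter.IsRennerCoxeterSystem.opposite`). In such a system `W_{λ(e)}` is the product of the
commuting subgroups `W_{λ^*(e)}` and `W_{λ_*(e)}`, and standard forms are unique.

*Vanilla forms.* The middle factor is `σ₀ = b z w₀` with `b ∈ W_{λ^*(e₋)}` and `z` of maximal length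
in `W_{λ_*(e₋)}`. Hence `e₋ σ₀ = σ₀ e₊`, the left standard form of `r` is `(σ₋ σ₀) e₊ σ₊` and its
right standard form is `σ₋ e₋ (σ₀ σ₊)`; the minimality of `σ₋ σ₀` modulo `W_{λ_*(e₊)}` is the
maximality of `z`. By uniqueness both adherence orders can be read off from these forms. For fixed
`w₊` the inequality `σ₋ σ₀ ≤ τ₋ τ₀ w₊` is equivalent to `τ₋ τ₀ w₊ w₀ ≤ σ₋ (σ₀ w₀)`. Lengths add in
the product on the right, as `σ₋ ∈ W^{λ(e₋)}` and `σ₀ w₀ ∈ W_{λ(e₋)}`, so this says that there is a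
`w₋` with `τ₋ w₋⁻¹ ≤ σ₋` and `w₋ τ₀ w₊ w₀ ≤ σ₀ w₀`, i.e. `σ₀ ≤ w₋ τ₀ w₊`. Such a `w₋` satisfies
`w₋ τ₀ w₊ w₀ ∈ W_{λ(e₋)}`, which forces `w₋ ∈ W_{λ_*(e₋)} W_{λ^*(f₋)}`
(`RennerCoxeter.IsVanilla.left_bruhatLE_iff`). The comparison with `≤⁻` is the mirror image,
obtained by passing to inverses.
-/

namespace CoxeterSystem

variable {B W : Type*} [Group W] {M : CoxeterMatrix B} (cs : CoxeterSystem M W)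

/-! ### The strong exchange property -/

open Classical in
/-- The permutation `(t, ε) ↦ (s t s, ε + [t = s])` of `W × ZMod 2` attached to the simple
reflection `s`; the first factor is all of `W`, not only the set of reflections. -/
noncomputable def signedConj (i : B) : Equiv.Perm (W × ZMod 2) where
  toFun p := (cs.simple i * p.1 * cs.simple i, p.2 + if p.1 = cs.simple i then 1 else 0)
  invFun p := (cs.simple i * p.1 * cs.simple i, p.2 + if p.1 = cs.simple i then 1 else 0)
  left_inv p := by
    have h : cs.simple i * p.1 * cs.simple i = cs.simple i ↔ p.1 = cs.simple i := by
      rw [mul_eq_right, mul_eq_one_iff_eq_inv', inv_simple]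
    ext1
    · simp [mul_assoc]
    · simp only [h, add_assoc, CharTwo.add_self_eq_zero, add_zero]
  right_inv p := by
    have h : cs.simple i * p.1 * cs.simple i = cs.simple i ↔ p.1 = cs.simple i := by
      rw [mul_eq_right, mul_eq_one_iff_eq_inv', inv_simple]
    ext1
    · simp [mul_assoc]
    · simp only [h, add_assoc, CharTwo.add_self_eq_zero, add_zero]

open Classical in
theorem signedConj_apply (i : B) (p : W × ZMod 2) :
    cs.signedConj i p =
      (cs.simple i * p.1 * cs.simple i, p.2 + if p.1 = cs.simple i then 1 else 0) := rfl

theorem simple_mul_pow_mul (i j : B) (n : ℕ) :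
    cs.simple j * (cs.simple i * cs.simple j) ^ n =
      ((cs.simple i * cs.simple j) ^ n)⁻¹ * cs.simple j := by
  induction n with
  | zero => simp
  | succ n ih =>
    rw [pow_succ, ← mul_assoc, ih, ← pow_succ, pow_succ', mul_inv_rev]
    simp [mul_assoc]

open Classical in
/-- The reflections that contribute a sign along `(s_i s_j)ⁿ` are the `s_j (s_i s_j)ᵏ` with
`k < 2 n`. -/
theorem signedConj_mul_pow_apply (i j : B) (n : ℕ) (t : W) (ε : ZMod 2) :
    ((cs.signedConj i * cs.signedConj j) ^ n) (t, ε) =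
      ((cs.simple i * cs.simple j) ^ n * t * ((cs.simple i * cs.simple j) ^ n)⁻¹,
        ε + ∑ k ∈ Finset.range (2 * n),
          if t = cs.simple j * (cs.simple i * cs.simple j) ^ k then 1 else 0) := by
  induction n with
  | zero => simp
  | succ n ih =>
    have hj := cs.simple_mul_pow_mul i j n
    set x := cs.simple i * cs.simple j with hx
    have h1 : x ^ n * t * (x ^ n)⁻¹ = cs.simple j ↔ t = cs.simple j * x ^ (2 * n) := by
      rw [two_mul, pow_add, ← mul_assoc, hj, mul_inv_eq_iff_eq_mul, mul_assoc (x ^ n)⁻¹,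
        eq_inv_mul_iff_mul_eq]
    have h2 : cs.simple j * (x ^ n * t * (x ^ n)⁻¹) * cs.simple j = cs.simple i ↔
        t = cs.simple j * x ^ (2 * n + 1) := by
      have : cs.simple j * x ^ (2 * n + 1) = (x ^ n)⁻¹ * (cs.simple j * x) * x ^ n := by
        rw [two_mul, add_assoc, pow_add, ← mul_assoc, hj, pow_succ']
        simp only [mul_assoc]
      rw [this, ← mul_inv_eq_iff_eq_mul, eq_inv_mul_iff_mul_eq, ← mul_assoc (x ^ n), hx,
        ← mul_left_cancel_iff (a := cs.simple j), ← mul_right_cancel_iff (a := cs.simple j)]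
      simp [mul_assoc]
    rw [pow_succ', Equiv.Perm.mul_apply, ih, Equiv.Perm.mul_apply, signedConj_apply,
      signedConj_apply]
    ext1
    · rw [pow_succ' x, mul_inv_rev, hx]
      simp [mul_assoc]
    · simp only [h1, h2]
      rw [show 2 * (n + 1) = 2 * n + 1 + 1 by ring, Finset.sum_range_succ, Finset.sum_range_succ]
      ring

theorem isLiftable_signedConj : M.IsLiftable cs.signedConj := by
  classical
  intro i j
  ext1 ⟨t, ε⟩
  have hx : (cs.simple i * cs.simple j) ^ M i j = 1 := cs.simple_mul_simple_pow i j
  rw [signedConj_mul_pow_apply, hx, two_mul, Finset.sum_range_add]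
  simp [pow_add, hx, CharTwo.add_self_eq_zero]

/-- The action of `W` on `W × ZMod 2` by signed conjugation. -/
noncomputable def signedConjHom : W →* Equiv.Perm (W × ZMod 2) :=
  cs.lift ⟨cs.signedConj, cs.isLiftable_signedConj⟩

open Classical in
theorem signedConjHom_wordProd_apply (ω : List B) (t : W) (ε : ZMod 2) :
    cs.signedConjHom (cs.wordProd ω) (t, ε) =
      (cs.wordProd ω * t * (cs.wordProd ω)⁻¹, ε + ((cs.rightInvSeq ω).count t : ZMod 2)) := by
  induction ω with
  | nil => simp
  | cons i ω ih =>
    have h : cs.wordProd ω * t * (cs.wordProd ω)⁻¹ = cs.simple i ↔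
        (cs.wordProd ω)⁻¹ * cs.simple i * cs.wordProd ω = t := by
      rw [mul_inv_eq_iff_eq_mul, mul_assoc, inv_mul_eq_iff_eq_mul, eq_comm]
    rw [wordProd_cons, map_mul, Equiv.Perm.mul_apply, ih, signedConjHom, lift_apply_simple,
      signedConj_apply, rightInvSeq, List.count_cons]
    ext1
    · simp [mul_assoc]
    · simp only [h, beq_iff_eq]
      push_cast
      ring

theorem signedConjHom_apply_add (w t : W) (ε δ : ZMod 2) :
    cs.signedConjHom w (t, ε + δ) =
      ((cs.signedConjHom w (t, ε)).1, (cs.signedConjHom w (t, ε)).2 + δ) := by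
  classical
  obtain ⟨ω, rfl⟩ := cs.wordProd_surjective w
  simp only [signedConjHom_wordProd_apply]
  ext1
  · rfl
  · simp only
    ring

/-- A reflection changes its own sign: conjugation reduces this to a simple reflection. -/
theorem signedConjHom_reflection_apply {t : W} (ht : cs.IsReflection t) :
    cs.signedConjHom t (t, 0) = (t, 1) := by
  classical
  obtain ⟨u, i, rfl⟩ := ht
  set t := u * cs.simple i * u⁻¹ with ht
  obtain ⟨a, ha⟩ : ∃ a, cs.signedConjHom u⁻¹ (t, 0) = (cs.simple i, a) := by
    obtain ⟨ω, hω⟩ := cs.wordProd_surjective u⁻¹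
    rw [← hω, signedConjHom_wordProd_apply, hω, ht]
    exact ⟨_, Prod.ext (by simp [mul_assoc]) rfl⟩
  have hu : cs.signedConjHom u (cs.simple i, a) = (t, 0) := by
    rw [← ha, ← Equiv.Perm.mul_apply, ← map_mul]
    simp
  calc cs.signedConjHom t (t, 0)
      = cs.signedConjHom u (cs.signedConjHom (cs.simple i) (cs.signedConjHom u⁻¹ (t, 0))) := by
        rw [← Equiv.Perm.mul_apply, ← Equiv.Perm.mul_apply, ← map_mul, ← map_mul]
    _ = cs.signedConjHom u (cs.simple i, a + 1) := by
        rw [ha, signedConjHom, lift_apply_simple, signedConj_apply]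
        simp
    _ = (t, 1) := by rw [signedConjHom_apply_add, hu]; simp

/-- Every right inversion of `w` occurs in the right inversion sequence of every word for `w`:
it occurs an odd number of times, since otherwise it would be a right inversion of `w t`. -/
theorem mem_rightInvSeq_of_isRightInversion {ω : List B} {t : W}
    (h : cs.IsRightInversion (cs.wordProd ω) t) : t ∈ cs.rightInvSeq ω := by
  classical
  by_contra hmem
  obtain ⟨ht, hlt⟩ := h
  obtain ⟨ω', hω', hp⟩ := cs.exists_isReduced (cs.wordProd ω * t)
  have h1 : cs.signedConjHom (cs.wordProd ω * t) (t, 0) =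
      (cs.wordProd ω * t * (cs.wordProd ω)⁻¹, 1) := by
    rw [map_mul, Equiv.Perm.mul_apply, cs.signedConjHom_reflection_apply ht,
      signedConjHom_wordProd_apply, List.count_eq_zero_of_not_mem hmem]
    simp
  rw [hp, signedConjHom_wordProd_apply] at h1
  have h2 : t ∈ cs.rightInvSeq ω' := by
    by_contra hmem'
    simp [List.count_eq_zero_of_not_mem hmem'] at h1
  have h3 := (cs.isRightInversion_of_mem_rightInvSeq hω' h2).2
  rw [← hp, mul_assoc, ht.mul_self, mul_one] at h3
  omega

/-- The strong exchange property. -/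
theorem exists_eraseIdx_of_isRightInversion {ω : List B} {t : W}
    (h : cs.IsRightInversion (cs.wordProd ω) t) :
    ∃ j < ω.length, cs.wordProd ω * t = cs.wordProd (ω.eraseIdx j) := by
  obtain ⟨j, hj, rfl⟩ := List.mem_iff_getElem.1 (cs.mem_rightInvSeq_of_isRightInversion h)
  refine ⟨j, by simpa using hj, ?_⟩
  rw [← cs.wordProd_mul_getD_rightInvSeq, List.getD_eq_getElem _ 1 hj]

/-- The deletion property. -/
theorem exists_isReduced_sublist (ω : List B) :
    ∃ ω' : List B, ω'.Sublist ω ∧ cs.IsReduced ω' ∧ cs.wordProd ω' = cs.wordProd ω := by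
  induction ω using List.reverseRecOn with
  | nil => exact ⟨[], List.Sublist.slnil, by simp [IsReduced], rfl⟩
  | append_singleton ω i ih =>
    obtain ⟨ω', hsub, hred, hp⟩ := ih
    rcases cs.length_mul_simple (cs.wordProd ω') i with h | h
    · refine ⟨ω' ++ [i], hsub.append_right [i], ?_, by simp [wordProd_append, hp]⟩
      simpa [IsReduced, wordProd_append, hred.eq] using h
    · obtain ⟨j, hj, he⟩ := cs.exists_eraseIdx_of_isRightInversion (ω := ω') (t := cs.simple i)
        ⟨cs.isReflection_simple i, by omega⟩
      refine ⟨ω'.eraseIdx j, ?_, ?_, ?_⟩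
      · exact (List.eraseIdx_sublist _ _).trans (hsub.trans (List.sublist_append_left _ _))
      · have := List.length_eraseIdx_add_one hj
        have := hred.eq
        rw [IsReduced, ← he]
        omega
      · rw [← he, hp, wordProd_append, wordProd_singleton]

/-! ### The Bruhat order -/

/-- A subword of a reduced word represents a smaller element, even if it is not reduced. -/
theorem bruhatLE_of_sublist {ω ω' : List B} (hω : cs.IsReduced ω) (h : ω'.Sublist ω) :
    cs.bruhatLE (cs.wordProd ω') (cs.wordProd ω) := by
  obtain ⟨ω'', hsub, hred, hp⟩ := cs.exists_isReduced_sublist ω'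
  exact ⟨ω, ω'', hω, rfl, hred, hp, hsub.trans h⟩

theorem bruhatLE.length_le {cs : CoxeterSystem M W} {u v : W} (h : cs.bruhatLE u v) :
    cs.length u ≤ cs.length v := by
  obtain ⟨ω, ω', hω, rfl, hω', rfl, hsub⟩ := h
  rw [hω.eq, hω'.eq]
  exact hsub.length_le

theorem bruhatLE.inv {cs : CoxeterSystem M W} {u v : W} (h : cs.bruhatLE u v) :
    cs.bruhatLE u⁻¹ v⁻¹ := by
  obtain ⟨ω, ω', hω, rfl, hω', rfl, hsub⟩ := h
  exact ⟨ω.reverse, ω'.reverse, hω.reverse, cs.wordProd_reverse ω, hω'.reverse,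
    cs.wordProd_reverse ω', hsub.reverse⟩

theorem bruhatLE_inv_iff {u v : W} : cs.bruhatLE u⁻¹ v⁻¹ ↔ cs.bruhatLE u v :=
  ⟨fun h ↦ by simpa using h.inv, fun h ↦ h.inv⟩

/-- An element-wise form of the strong exchange property for a product `x y`: the deleted letter
belongs to a reduced word of `x` or to one of `y`. -/
theorem exchange_mul {x y t : W} (ht : cs.IsReflection t)
    (h : cs.length (x * y * t) < cs.length (x * y)) :
    (∃ x', cs.bruhatLE x' x ∧ cs.length x' < cs.length x ∧ x * y * t = x' * y) ∨
      cs.length (y * t) < cs.length y := by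
  obtain ⟨ω₁, h₁, rfl⟩ := cs.exists_isReduced x
  obtain ⟨ω₂, h₂, rfl⟩ := cs.exists_isReduced y
  rw [← wordProd_append] at h
  obtain ⟨j, hj, he⟩ := cs.exists_eraseIdx_of_isRightInversion ⟨ht, h⟩
  rcases lt_or_ge j ω₁.length with hlt | hge
  · left
    rw [List.eraseIdx_append_of_lt_length hlt, wordProd_append, wordProd_append] at he
    refine ⟨_, cs.bruhatLE_of_sublist h₁ (List.eraseIdx_sublist _ _), ?_, he⟩
    have := List.length_eraseIdx_add_one hlt
    have := cs.length_wordProd_le (ω₁.eraseIdx j)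
    have := h₁.eq
    omega
  · right
    rw [List.eraseIdx_append_of_length_le hge, wordProd_append, wordProd_append, mul_assoc,
      mul_right_inj] at he
    rw [List.length_append] at hj
    have := List.length_eraseIdx_add_one (l := ω₂) (i := j - ω₁.length) (by omega)
    have := cs.length_wordProd_le (ω₂.eraseIdx (j - ω₁.length))
    have := h₂.eq
    rw [he]
    omega

/-- The elementary relation `u → u t`, with `t` a reflection and `ℓ(u) < ℓ(u t)`, that generates
the Bruhat order. -/
def BruhatStep (u v : W) : Prop :=
  ∃ t, cs.IsReflection t ∧ v = u * t ∧ cs.length u < cs.length v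

/-- The lifting property: multiplying both sides of `u → v` by a simple reflection on the right
either preserves the relation or yields `u s = v`. -/
theorem BruhatStep.mul_simple {cs : CoxeterSystem M W} {u v : W} (h : cs.BruhatStep u v) (i : B) :
    u * cs.simple i = v ∨ cs.BruhatStep (u * cs.simple i) (v * cs.simple i) := by
  obtain ⟨t, ht, rfl, hlt⟩ := h
  have ht' : cs.IsReflection (cs.simple i * t * cs.simple i) := by
    simpa using ht.conj (cs.simple i)
  have he : u * t * cs.simple i = u * cs.simple i * (cs.simple i * t * cs.simple i) := by
    simp [mul_assoc]
  by_cases hl : cs.length (u * cs.simple i) < cs.length (u * t * cs.simple i)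
  · exact Or.inr ⟨_, ht', he, hl⟩
  -- Otherwise strong exchange applies to `u s` and the reflection `s t s`; a deletion in `u` would
  -- make `u t` shorter than `u`.
  · left
    have hne := ht'.length_mul_left_ne (u * cs.simple i)
    rw [← he] at hne
    rcases cs.exchange_mul (x := u) (y := cs.simple i) ht' (by rw [← he]; omega) with
      ⟨x', -, hx', hx⟩ | h'
    · rw [← he, mul_left_inj] at hx
      rw [hx] at hlt
      omega
    · rw [length_simple, Nat.lt_one_iff, length_eq_zero_iff, ← mul_assoc, ← mul_assoc,
        simple_mul_simple_self, one_mul, mul_eq_one_iff_eq_inv, inv_simple] at h'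
      rw [h']

/-- The transitive closure of the elementary relations descends to subwords of arbitrary words. -/
theorem exists_sublist_of_reflTransGen {u : W} {ω : List B}
    (h : Relation.ReflTransGen cs.BruhatStep u (cs.wordProd ω)) :
    ∃ ω' : List B, ω'.Sublist ω ∧ cs.wordProd ω' = u := by
  induction h using Relation.ReflTransGen.head_induction_on with
  | refl => exact ⟨ω, List.Sublist.refl _, rfl⟩
  | head hstep _ ih =>
    obtain ⟨ω', hsub, rfl⟩ := ih
    obtain ⟨t, ht, he, hlt⟩ := hstep
    rw [← mul_inv_eq_iff_eq_mul, ht.inv] at he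
    rw [← he] at hlt
    obtain ⟨j, -, hj⟩ := cs.exists_eraseIdx_of_isRightInversion ⟨ht, hlt⟩
    exact ⟨ω'.eraseIdx j, (List.eraseIdx_sublist _ _).trans hsub, by rw [← hj, he]⟩

theorem reflTransGen_mul_simple {u v : W} (h : Relation.ReflTransGen cs.BruhatStep u v) (i : B) :
    Relation.ReflTransGen cs.BruhatStep (u * cs.simple i) v ∨
      Relation.ReflTransGen cs.BruhatStep (u * cs.simple i) (v * cs.simple i) := by
  induction h using Relation.ReflTransGen.head_induction_on with
  | refl => exact Or.inr .refl
  | head hstep hrest ih =>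
    rcases hstep.mul_simple i with he | hs
    · exact Or.inl (he ▸ hrest)
    · exact ih.imp (.head hs) (.head hs)

theorem reflTransGen_of_sublist {ω ω' : List B} (hω : cs.IsReduced ω) (h : ω'.Sublist ω) :
    Relation.ReflTransGen cs.BruhatStep (cs.wordProd ω') (cs.wordProd ω) := by
  induction ω using List.reverseRecOn generalizing ω' with
  | nil => rw [List.sublist_nil.1 h]
  | append_singleton ω i ih =>
    have hred : cs.IsReduced ω := by simpa using hω.take ω.length
    have hstep : cs.BruhatStep (cs.wordProd ω) (cs.wordProd (ω ++ [i])) := by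
      refine ⟨cs.simple i, cs.isReflection_simple i, by simp [wordProd_append], ?_⟩
      rw [hred.eq, hω.eq]
      simp
    obtain ⟨l₁, l₂, rfl, h₁, h₂⟩ := List.sublist_append_iff.1 h
    rcases List.sublist_singleton.1 h₂ with rfl | rfl
    · rw [List.append_nil]
      exact (ih hred h₁).tail hstep
    · rw [wordProd_append, wordProd_singleton]
      rcases cs.reflTransGen_mul_simple (ih hred h₁) i with h' | h'
      · exact h'.tail hstep
      · rwa [wordProd_append, wordProd_singleton]

theorem bruhatLE_iff_reflTransGen {u v : W} :
    cs.bruhatLE u v ↔ Relation.ReflTransGen cs.BruhatStep u v := by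
  constructor
  · rintro ⟨ω, ω', hω, rfl, -, rfl, hsub⟩
    exact cs.reflTransGen_of_sublist hω hsub
  · intro h
    obtain ⟨ω, hω, rfl⟩ := cs.exists_isReduced v
    obtain ⟨ω', hsub, rfl⟩ := cs.exists_sublist_of_reflTransGen h
    exact cs.bruhatLE_of_sublist hω hsub

/-- The subword property holds for every reduced word of the larger element. -/
theorem bruhatLE.exists_sublist {cs : CoxeterSystem M W} {u : W} {ω : List B}
    (h : cs.bruhatLE u (cs.wordProd ω)) : ∃ ω' : List B, ω'.Sublist ω ∧ cs.wordProd ω' = u :=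
  cs.exists_sublist_of_reflTransGen (cs.bruhatLE_iff_reflTransGen.1 h)

/-- The Bruhat interval below a reduced product `a b` is the product of the intervals below `a`
and below `b`. -/
theorem bruhatLE_mul_iff {a b u : W} (hab : cs.length (a * b) = cs.length a + cs.length b) :
    cs.bruhatLE u (a * b) ↔ ∃ p q, cs.bruhatLE p a ∧ cs.bruhatLE q b ∧ u = p * q := by
  obtain ⟨ω₁, h₁, rfl⟩ := cs.exists_isReduced a
  obtain ⟨ω₂, h₂, rfl⟩ := cs.exists_isReduced b
  have hred : cs.IsReduced (ω₁ ++ ω₂) := by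
    rw [IsReduced, wordProd_append, hab, h₁.eq, h₂.eq, List.length_append]
  rw [← wordProd_append]
  constructor
  · intro h
    obtain ⟨ω', hsub, rfl⟩ := h.exists_sublist
    obtain ⟨l₁, l₂, rfl, hl₁, hl₂⟩ := List.sublist_append_iff.1 hsub
    exact ⟨_, _, cs.bruhatLE_of_sublist h₁ hl₁, cs.bruhatLE_of_sublist h₂ hl₂,
      cs.wordProd_append _ _⟩
  · rintro ⟨p, q, hp, hq, rfl⟩
    obtain ⟨l₁, hl₁, rfl⟩ := hp.exists_sublist
    obtain ⟨l₂, hl₂, rfl⟩ := hq.exists_sublist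
    rw [← wordProd_append]
    exact cs.bruhatLE_of_sublist hred (hl₁.append hl₂)

/-! ### Parabolic subgroups and minimal coset representatives -/

theorem bruhatLE_refl (u : W) : cs.bruhatLE u u :=
  cs.bruhatLE_iff_reflTransGen.2 .refl

theorem one_bruhatLE (u : W) : cs.bruhatLE 1 u := by
  obtain ⟨ω, hω, rfl⟩ := cs.exists_isReduced u
  simpa using cs.bruhatLE_of_sublist hω (List.nil_sublist ω)

theorem simple_mem_parabolic {J : Set B} {i : B} (hi : i ∈ J) : cs.simple i ∈ cs.parabolic J :=
  Subgroup.subset_closure (Set.mem_image_of_mem _ hi)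

theorem parabolic_mono {I J : Set B} (h : I ⊆ J) : cs.parabolic I ≤ cs.parabolic J :=
  Subgroup.closure_mono (Set.image_mono h)

theorem wordProd_mem_parabolic {J : Set B} {ω : List B} (h : ∀ i ∈ ω, i ∈ J) :
    cs.wordProd ω ∈ cs.parabolic J := by
  induction ω with
  | nil => simp
  | cons i ω ih =>
    rw [wordProd_cons]
    exact mul_mem (cs.simple_mem_parabolic (h i (by simp))) (ih fun j hj ↦ h j (by simp [hj]))

theorem exists_isReduced_of_mem_parabolic {J : Set B} {w : W} (hw : w ∈ cs.parabolic J) :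
    ∃ ω : List B, (∀ i ∈ ω, i ∈ J) ∧ cs.IsReduced ω ∧ cs.wordProd ω = w := by
  have : ∃ ω : List B, (∀ i ∈ ω, i ∈ J) ∧ cs.wordProd ω = w := by
    induction hw using Subgroup.closure_induction with
    | mem x hx =>
      obtain ⟨i, hi, rfl⟩ := hx
      exact ⟨[i], by simpa using hi, by simp⟩
    | one => exact ⟨[], by simp, by simp⟩
    | mul x y _ _ hx hy =>
      obtain ⟨ω, hω, rfl⟩ := hx
      obtain ⟨ω', hω', rfl⟩ := hy
      exact ⟨ω ++ ω', fun i hi ↦ (List.mem_append.1 hi).elim (hω i) (hω' i),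
        cs.wordProd_append ω ω'⟩
    | inv x _ hx =>
      obtain ⟨ω, hω, rfl⟩ := hx
      exact ⟨ω.reverse, by simpa using hω, cs.wordProd_reverse ω⟩
  obtain ⟨ω, hω, rfl⟩ := this
  obtain ⟨ω', hsub, hred, hp⟩ := cs.exists_isReduced_sublist ω
  exact ⟨ω', fun i hi ↦ hω i (hsub.subset hi), hred, hp⟩

theorem mem_parabolic_of_bruhatLE {J : Set B} {u w : W} (hw : w ∈ cs.parabolic J)
    (h : cs.bruhatLE u w) : u ∈ cs.parabolic J := by
  obtain ⟨ω, hω, -, rfl⟩ := cs.exists_isReduced_of_mem_parabolic hw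
  obtain ⟨ω', hsub, rfl⟩ := h.exists_sublist
  exact cs.wordProd_mem_parabolic fun i hi ↦ hω i (hsub.subset hi)

theorem mem_minReps_empty_left_iff {J : Set B} {u : W} :
    u ∈ cs.minReps ∅ J ↔ ∀ c ∈ cs.parabolic J, cs.bruhatLE u (u * c) := by
  simp only [minReps, DoubleCoset.mem_doubleCoset, parabolic, Set.mem_ofPred_eq, Set.image_empty,
    Subgroup.closure_empty, Subgroup.coe_bot, Set.mem_singleton_iff, SetLike.mem_coe,
    exists_eq_left, one_mul]
  exact ⟨fun h c hc ↦ h _ ⟨c, hc, rfl⟩, by rintro h _ ⟨c, hc, rfl⟩; exact h c hc⟩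

theorem mem_minReps_empty_right_iff {J : Set B} {u : W} :
    u ∈ cs.minReps J ∅ ↔ ∀ c ∈ cs.parabolic J, cs.bruhatLE u (c * u) := by
  simp only [minReps, DoubleCoset.mem_doubleCoset, parabolic, Set.mem_ofPred_eq, Set.image_empty,
    Subgroup.closure_empty, Subgroup.coe_bot, Set.mem_singleton_iff, SetLike.mem_coe,
    exists_eq_left, mul_one]
  exact ⟨fun h c hc ↦ h _ ⟨c, hc, rfl⟩, by rintro h _ ⟨c, hc, rfl⟩; exact h c hc⟩

theorem inv_mem_minReps_iff {J : Set B} {u : W} :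
    u⁻¹ ∈ cs.minReps ∅ J ↔ u ∈ cs.minReps J ∅ := by
  rw [mem_minReps_empty_left_iff, mem_minReps_empty_right_iff]
  refine ⟨fun h c hc ↦ ?_, fun h c hc ↦ ?_⟩
  · rw [← bruhatLE_inv_iff, mul_inv_rev]
    exact h _ (inv_mem hc)
  · rw [← bruhatLE_inv_iff, mul_inv_rev, inv_inv]
    exact h _ (inv_mem hc)

/-- Lengths add along a coset `x W_J` when `x` has minimal length in it. -/
theorem length_mul_of_forall_length_le {J : Set B} {x c : W}
    (hx : ∀ d ∈ cs.parabolic J, cs.length x ≤ cs.length (x * d)) (hc : c ∈ cs.parabolic J) :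
    cs.length (x * c) = cs.length x + cs.length c := by
  obtain ⟨ω, hω, hred, rfl⟩ := cs.exists_isReduced_of_mem_parabolic hc
  clear hc
  induction ω using List.reverseRecOn with
  | nil => simp
  | append_singleton ω i ih =>
    have hi : cs.simple i ∈ cs.parabolic J := cs.simple_mem_parabolic (hω i (by simp))
    have hωJ : ∀ j ∈ ω, j ∈ J := fun j hj ↦ hω j (by simp [hj])
    have hred' : cs.IsReduced ω := by simpa using hred.take ω.length
    have hmem := cs.wordProd_mem_parabolic hωJ
    have ih := ih hωJ hred'
    have hlen := hred.eq
    rw [List.length_append, List.length_singleton, ← hred'.eq] at hlen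
    rw [hlen]
    rw [wordProd_append, wordProd_singleton] at hlen ⊢
    rcases cs.length_mul_simple (x * cs.wordProd ω) i with h | h
    · rw [← mul_assoc]
      omega
    · rcases cs.exchange_mul (x := x) (y := cs.wordProd ω) (cs.isReflection_simple i) (by omega)
        with ⟨x', -, hx', he⟩ | h'
      -- A deletion in `x` would give a shorter element `x'` of the coset `x W_J`.
      · have := hx (cs.wordProd ω * cs.simple i * (cs.wordProd ω)⁻¹)
          (mul_mem (mul_mem hmem hi) (inv_mem hmem))
        rw [← mul_assoc, ← mul_assoc, he, mul_inv_cancel_right] at this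
        omega
      · omega

theorem length_mul_of_mem_minReps {J : Set B} {x c : W} (hx : x ∈ cs.minReps ∅ J)
    (hc : c ∈ cs.parabolic J) : cs.length (x * c) = cs.length x + cs.length c :=
  cs.length_mul_of_forall_length_le
    (fun d hd ↦ (cs.mem_minReps_empty_left_iff.1 hx d hd).length_le) hc

/-- An element of minimal length in `x W_J` is the minimum of `x W_J` for the Bruhat order. -/
theorem mem_minReps_of_forall_length_le {J : Set B} {x : W}
    (hx : ∀ d ∈ cs.parabolic J, cs.length x ≤ cs.length (x * d)) : x ∈ cs.minReps ∅ J :=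
  cs.mem_minReps_empty_left_iff.2 fun c hc ↦
    (cs.bruhatLE_mul_iff (cs.length_mul_of_forall_length_le hx hc)).2
      ⟨x, 1, cs.bruhatLE_refl x, cs.one_bruhatLE c, (mul_one x).symm⟩

theorem eq_one_of_mem_minReps {J : Set B} {x c : W} (hx : x ∈ cs.minReps ∅ J)
    (hxc : x * c ∈ cs.minReps ∅ J) (hc : c ∈ cs.parabolic J) : c = 1 := by
  have h₁ := cs.length_mul_of_mem_minReps hx hc
  have h₂ := cs.length_mul_of_mem_minReps hxc (inv_mem hc)
  rw [mul_inv_cancel_right] at h₂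
  rw [← cs.length_eq_zero_iff]
  omega

theorem eq_one_of_mem_minReps' {J : Set B} {x c : W} (hx : x ∈ cs.minReps J ∅)
    (hcx : c * x ∈ cs.minReps J ∅) (hc : c ∈ cs.parabolic J) : c = 1 := by
  rw [← inv_mem_minReps_iff] at hx hcx
  rw [mul_inv_rev] at hcx
  exact inv_eq_one.1 (cs.eq_one_of_mem_minReps hx hcx (inv_mem hc))

/-! ### Parabolic subgroups on disjoint sets of simple reflections -/

/-- The hypothesis compares simple reflections instead of their indices, so that injectivity of
`cs.simple` is not required. -/
theorem eq_one_of_mem_parabolic_of_mem_parabolic {I J : Set B}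
    (hd : ∀ i ∈ I, ∀ j ∈ J, cs.simple i ≠ cs.simple j) {x : W} (hI : x ∈ cs.parabolic I)
    (hJ : x ∈ cs.parabolic J) : x = 1 := by
  by_contra hx
  obtain ⟨ω, hω, hred, rfl⟩ := cs.exists_isReduced_of_mem_parabolic hI
  obtain rfl | ⟨ω, i, rfl⟩ := ω.eq_nil_or_concat'
  · simp at hx
  have hred' : cs.IsReduced ω := by simpa using hred.take ω.length
  have hlt : cs.length (cs.wordProd (ω ++ [i]) * cs.simple i) <
      cs.length (cs.wordProd (ω ++ [i])) := by
    rw [hred.eq, wordProd_append, wordProd_singleton, simple_mul_simple_cancel_right, hred'.eq]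
    simp
  obtain ⟨ω', hω', -, hp⟩ := cs.exists_isReduced_of_mem_parabolic hJ
  rw [← hp] at hlt
  obtain ⟨k, -, hk⟩ := cs.exists_eraseIdx_of_isRightInversion ⟨cs.isReflection_simple i, hlt⟩
  have hi : cs.simple i ∈ cs.parabolic J := by
    rw [← eq_inv_mul_iff_mul_eq] at hk
    rw [hk]
    refine mul_mem (inv_mem (hp ▸ hJ)) (cs.wordProd_mem_parabolic fun j hj ↦ ?_)
    exact hω' j ((List.eraseIdx_sublist _ _).subset hj)
  obtain ⟨ν, hν, hνred, hνp⟩ := cs.exists_isReduced_of_mem_parabolic hi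
  have hlen := hνred.eq
  rw [hνp, length_simple] at hlen
  obtain ⟨j, rfl⟩ := List.length_eq_one_iff.1 hlen.symm
  rw [wordProd_singleton] at hνp
  exact hd i (hω i (by simp)) j (hν j (by simp)) hνp.symm

/-- Lengths add in products of elements of parabolic subgroups on disjoint sets of simple
reflections. -/
theorem length_mul_of_disjoint {I J : Set B}
    (hd : ∀ i ∈ I, ∀ j ∈ J, cs.simple i ≠ cs.simple j) {b c : W} (hb : b ∈ cs.parabolic I)
    (hc : c ∈ cs.parabolic J) : cs.length (b * c) = cs.length b + cs.length c := by
  obtain ⟨ω, hω, hred, rfl⟩ := cs.exists_isReduced_of_mem_parabolic hc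
  clear hc
  induction ω using List.reverseRecOn with
  | nil => simp
  | append_singleton ω i ih =>
    have hi : cs.simple i ∈ cs.parabolic J := cs.simple_mem_parabolic (hω i (by simp))
    have hωJ : ∀ j ∈ ω, j ∈ J := fun j hj ↦ hω j (by simp [hj])
    have hred' : cs.IsReduced ω := by simpa using hred.take ω.length
    have hmem := cs.wordProd_mem_parabolic hωJ
    have ih := ih hωJ hred'
    have hlen := hred.eq
    rw [List.length_append, List.length_singleton, ← hred'.eq] at hlen
    rw [hlen]
    rw [wordProd_append, wordProd_singleton] at hlen ⊢
    rcases cs.length_mul_simple (b * cs.wordProd ω) i with h | h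
    · rw [← mul_assoc]
      omega
    · rcases cs.exchange_mul (x := b) (y := cs.wordProd ω) (cs.isReflection_simple i) (by omega)
        with ⟨b', hb', -, he⟩ | h'
      -- After a deletion in `b`, the element `b⁻¹ b'` lies in `W_I ∩ W_J` and is a conjugate of a
      -- simple reflection.
      · have h1 : b⁻¹ * b' = cs.wordProd ω * cs.simple i * (cs.wordProd ω)⁻¹ := by
          rw [inv_mul_eq_iff_eq_mul, ← mul_assoc, ← mul_assoc, he, mul_inv_cancel_right]
        have h2 := cs.eq_one_of_mem_parabolic_of_mem_parabolic hd
          (mul_mem (inv_mem hb) (cs.mem_parabolic_of_bruhatLE hb hb'))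
          (h1 ▸ mul_mem (mul_mem hmem hi) (inv_mem hmem))
        rw [h1, mul_inv_eq_one, mul_eq_left] at h2
        have := cs.length_simple i
        simp [h2] at this
      · omega

/-- If a simple reflection outside `J` conjugates a generator of `W_J` into `W_J`, then the two
commute. -/
theorem simple_commute_of_conj_mem {I J : Set B}
    (hd : ∀ i ∈ I, ∀ j ∈ J, cs.simple i ≠ cs.simple j) {i j : B} (hi : i ∈ I) (hj : j ∈ J)
    (h : cs.simple i * cs.simple j * cs.simple i ∈ cs.parabolic J) :
    cs.simple i * cs.simple j = cs.simple j * cs.simple i := by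
  have hji := cs.length_mul_of_disjoint (fun j hj i hi ↦ (hd i hi j hj).symm) h
    (cs.simple_mem_parabolic hi)
  have hij := cs.length_mul_of_disjoint hd (cs.simple_mem_parabolic hi)
    (cs.simple_mem_parabolic hj)
  have hij' := cs.length_mul_of_disjoint (fun j hj i hi ↦ (hd i hi j hj).symm)
    (cs.simple_mem_parabolic hj) (cs.simple_mem_parabolic hi)
  simp only [simple_mul_simple_cancel_right, length_simple] at hji hij hij'
  rcases cs.exchange_mul (x := cs.simple i) (y := cs.simple j) (cs.isReflection_simple i)
    (by omega) with ⟨x', -, hx', he⟩ | h'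
  · rw [length_simple, Nat.lt_one_iff, length_eq_zero_iff] at hx'
    rw [hx', one_mul, ← eq_mul_inv_iff_mul_eq, inv_simple] at he
    exact he
  · rw [length_simple] at h'
    omega

theorem commute_of_mem_parabolic {I J : Set B}
    (h : ∀ i ∈ I, ∀ j ∈ J, cs.simple i * cs.simple j = cs.simple j * cs.simple i) {x y : W}
    (hx : x ∈ cs.parabolic I) (hy : y ∈ cs.parabolic J) : x * y = y * x := by
  have h1 : cs.parabolic I ≤ Subgroup.centralizer (cs.simple '' J) := by
    refine (Subgroup.closure_le _).2 ?_
    rintro _ ⟨i, hi, rfl⟩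
    rw [SetLike.mem_coe, Subgroup.mem_centralizer_iff]
    rintro _ ⟨j, hj, rfl⟩
    exact (h i hi j hj).symm
  have h2 : cs.parabolic J ≤ Subgroup.centralizer {x} := by
    refine (Subgroup.closure_le _).2 fun z hz ↦ ?_
    rw [SetLike.mem_coe, Subgroup.mem_centralizer_singleton_iff]
    exact (Subgroup.mem_centralizer_iff.1 (h1 hx) z hz)
  exact (Subgroup.mem_centralizer_singleton_iff.1 (h2 hy)).symm

/-! ### The longest element -/

section Finite

variable [Finite W]

/-- By induction on `w`, the longest element has a reduced word that ends in a reduced word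
of `w`. -/
theorem length_longest_mul_inv_add (w : W) :
    cs.length (cs.longest * w⁻¹) + cs.length w = cs.length cs.longest := by
  obtain ⟨ω, hred, rfl⟩ := cs.exists_isReduced w
  induction ω using List.reverseRecOn with
  | nil => simp
  | append_singleton ω i ih =>
    have hred' : cs.IsReduced ω := by simpa using hred.take ω.length
    have ih := ih hred'
    have hlen := hred.eq
    rw [List.length_append, List.length_singleton, ← hred'.eq] at hlen
    rw [wordProd_append, wordProd_singleton] at hlen ⊢
    have hlt : cs.length (cs.longest * cs.simple i) < cs.length cs.longest :=
      lt_of_le_of_ne (cs.length_le_longest _) (cs.length_mul_simple_ne _ _)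
    have hle := cs.length_le_length_mul_add_right cs.longest (cs.wordProd ω * cs.simple i)⁻¹
    rw [length_inv] at hle
    -- The deleted letter lies in the left factor of `w₀ = (w₀ w⁻¹) w`, since `w s` is longer than `w`.
    rcases cs.exchange_mul (x := cs.longest * (cs.wordProd ω)⁻¹) (y := cs.wordProd ω)
      (cs.isReflection_simple i) (by rwa [inv_mul_cancel_right]) with ⟨x', -, hx', he⟩ | h'
    · rw [inv_mul_cancel_right, ← mul_inv_eq_iff_eq_mul, mul_assoc] at he
      rw [mul_inv_rev, inv_simple, he] at hle ⊢
      omega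
    · omega

theorem longest_mul_longest : cs.longest * cs.longest = 1 := by
  have h := cs.length_longest_mul_inv_add cs.longest⁻¹
  rw [inv_inv, length_inv] at h
  rw [← cs.length_eq_zero_iff]
  omega

theorem longest_inv : cs.longest⁻¹ = cs.longest :=
  inv_eq_of_mul_eq_one_left cs.longest_mul_longest

theorem longest_mul_cancel_left (w : W) : cs.longest * (cs.longest * w) = w := by
  rw [← mul_assoc, longest_mul_longest, one_mul]

theorem length_mul_longest_add (w : W) :
    cs.length (w * cs.longest) + cs.length w = cs.length cs.longest := by
  rw [← cs.length_inv (w * cs.longest), mul_inv_rev, longest_inv, length_longest_mul_inv_add]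

theorem length_longest_mul_add (w : W) :
    cs.length (cs.longest * w) + cs.length w = cs.length cs.longest := by
  simpa using cs.length_longest_mul_inv_add w⁻¹

theorem length_longest_conj (w : W) :
    cs.length (cs.longest * w * cs.longest) = cs.length w := by
  have h₁ := cs.length_mul_longest_add (cs.longest * w)
  have h₂ := cs.length_longest_mul_add w
  omega

theorem longest_conj_conj (w : W) :
    cs.longest * (cs.longest * w * cs.longest) * cs.longest = w := by
  rw [mul_assoc cs.longest w, ← mul_assoc, longest_mul_longest, one_mul, mul_assoc,
    longest_mul_longest, mul_one]

theorem exists_simple_eq_longest_conj (i : B) :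
    ∃ j, cs.longest * cs.simple i * cs.longest = cs.simple j :=
  cs.length_eq_one_iff.1 (by rw [length_longest_conj, length_simple])

theorem bruhatLE.mul_longest {cs : CoxeterSystem M W} {u v : W} (h : cs.bruhatLE u v) :
    cs.bruhatLE (v * cs.longest) (u * cs.longest) := by
  rw [bruhatLE_iff_reflTransGen] at h ⊢
  refine Relation.ReflTransGen.lift (r := Function.swap cs.BruhatStep) (· * cs.longest) ?_
    _ _ (Relation.ReflTransGen.swap _ _ h)
  rintro v u ⟨t, ht, rfl, hlt⟩
  refine ⟨cs.longest⁻¹ * t * cs.longest, by simpa using ht.conj cs.longest⁻¹, ?_, ?_⟩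
  · simp only [mul_assoc, mul_inv_cancel_left]
    rw [← mul_assoc t t, ht.mul_self, one_mul]
  · have h₁ := cs.length_mul_longest_add (u * t)
    have h₂ := cs.length_mul_longest_add u
    dsimp only
    omega

/-- Right multiplication by the longest element reverses the Bruhat order. -/
theorem mul_longest_bruhatLE_mul_longest_iff {u v : W} :
    cs.bruhatLE (v * cs.longest) (u * cs.longest) ↔ cs.bruhatLE u v := by
  refine ⟨fun h ↦ ?_, fun h ↦ h.mul_longest⟩
  simpa [mul_assoc, longest_mul_longest] using h.mul_longest

theorem longest_conj_mem_parabolic {I J : Set B}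
    (h : ∀ i ∈ I, ∃ j ∈ J, cs.longest * cs.simple i * cs.longest = cs.simple j) {x : W}
    (hx : x ∈ cs.parabolic I) : cs.longest * x * cs.longest ∈ cs.parabolic J := by
  have : cs.parabolic I ≤ (cs.parabolic J).comap (MulAut.conj cs.longest).toMonoidHom := by
    refine (Subgroup.closure_le _).2 ?_
    rintro _ ⟨i, hi, rfl⟩
    obtain ⟨j, hj, he⟩ := h i hi
    simpa [longest_inv, he] using cs.simple_mem_parabolic hj
  simpa [longest_inv] using this hx

/-! ### Comparison of products with the longest element -/

theorem mul_bruhatLE_mul_of_bruhatLE {T : Set B} {σ σ₀ τ q w : W} (hσ : σ ∈ cs.minReps ∅ T)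
    (hσ₀ : σ₀ * cs.longest ∈ cs.parabolic T) (h₁ : cs.bruhatLE (τ * w⁻¹) σ)
    (h₂ : cs.bruhatLE σ₀ (w * q)) : cs.bruhatLE (σ * σ₀) (τ * q) := by
  rw [← mul_longest_bruhatLE_mul_longest_iff, mul_assoc σ,
    cs.bruhatLE_mul_iff (cs.length_mul_of_mem_minReps hσ hσ₀)]
  exact ⟨_, _, h₁, h₂.mul_longest, by group⟩

/-- After multiplication by the longest element on the right the inequality reads
`τ q w₀ ≤ σ (σ₀ w₀)`, and lengths add in the product on the right, so that `τ q w₀` factors as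
`(τ w⁻¹) (w q w₀)` with factors below `σ` and `σ₀ w₀`. -/
theorem exists_of_mul_bruhatLE_mul {T : Set B} {σ σ₀ τ q : W} (hσ : σ ∈ cs.minReps ∅ T)
    (hσ₀ : σ₀ * cs.longest ∈ cs.parabolic T) (h : cs.bruhatLE (σ * σ₀) (τ * q)) :
    ∃ w, w * (q * cs.longest) ∈ cs.parabolic T ∧ cs.bruhatLE (τ * w⁻¹) σ ∧
      cs.bruhatLE σ₀ (w * q) := by
  rw [← mul_longest_bruhatLE_mul_longest_iff, mul_assoc σ,
    cs.bruhatLE_mul_iff (cs.length_mul_of_mem_minReps hσ hσ₀)] at h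
  obtain ⟨a, b, ha, hb, he⟩ := h
  have hw : a⁻¹ * τ * (q * cs.longest) = b := by
    rw [mul_assoc, inv_mul_eq_iff_eq_mul, ← he, mul_assoc]
  refine ⟨a⁻¹ * τ, ?_, by simpa using ha, ?_⟩
  · rw [hw]
    exact cs.mem_parabolic_of_bruhatLE hσ₀ hb
  · rw [← mul_longest_bruhatLE_mul_longest_iff, mul_assoc, hw]
    exact hb

/-- The product of a minimal representative `σ` of `σ W_T` with `b z w₀`, where `z` has maximal
length in `W_J`, is minimal modulo `w₀ W_J w₀`: right multiplication by `w₀` reverses lengths, and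
`σ b z` is maximal in `σ b W_J`. -/
theorem mul_mem_minReps_of_longest {I J K T : Set B}
    (hd : ∀ i ∈ I, ∀ j ∈ J, cs.simple i ≠ cs.simple j)
    (hIT : cs.parabolic I ≤ cs.parabolic T) (hJT : cs.parabolic J ≤ cs.parabolic T)
    (hKJ : ∀ c ∈ cs.parabolic K, cs.longest * c * cs.longest ∈ cs.parabolic J)
    {σ b z : W} (hσ : σ ∈ cs.minReps ∅ T) (hb : b ∈ cs.parabolic I) (hz : z ∈ cs.parabolic J)
    (hmax : ∀ c ∈ cs.parabolic J, cs.length c ≤ cs.length z) :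
    σ * (b * z * cs.longest) ∈ cs.minReps ∅ K := by
  have key : ∀ c ∈ cs.parabolic J,
      cs.length (σ * (b * c)) = cs.length σ + (cs.length b + cs.length c) := fun c hc ↦ by
    rw [cs.length_mul_of_mem_minReps hσ (mul_mem (hIT hb) (hJT hc)),
      cs.length_mul_of_disjoint hd hb hc]
  refine cs.mem_minReps_of_forall_length_le fun c hc ↦ ?_
  have he : σ * (b * z * cs.longest) * c =
      σ * (b * (z * (cs.longest * c * cs.longest))) * cs.longest := by
    simp only [mul_assoc, longest_mul_longest, mul_one]
  have hm := mul_mem hz (hKJ c hc)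
  rw [he, ← mul_assoc σ]
  have h₁ := cs.length_mul_longest_add (σ * (b * z))
  have h₂ := cs.length_mul_longest_add (σ * (b * (z * (cs.longest * c * cs.longest))))
  rw [key _ hz] at h₁
  rw [key _ hm] at h₂
  have h₃ := hmax _ hm
  omega

end Finite

end CoxeterSystem

namespace RennerCoxeter

variable {R : Type*} [Monoid R]

/-! ### Idempotents of a factorizable monoid -/

theorem idemLE_refl {e : R} (he : IsIdempotentElem e) : idemLE e e := ⟨he.eq, he.eq⟩

theorem idemLE_trans {e f g : R} (h : idemLE e f) (h' : idemLE f g) : idemLE e g :=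
  ⟨by rw [← h.1, mul_assoc, h'.1], by rw [← h.2, ← mul_assoc, h'.2]⟩

theorem idemLE_antisymm {e f : R} (h : idemLE e f) (h' : idemLE f e) : e = f := by
  rw [← h.1, h'.2]

theorem idemLE_unit_conj (g : Rˣ) {e f : R} (h : idemLE e f) :
    idemLE ((g : R) * e * (g⁻¹ : Rˣ)) (g * f * (g⁻¹ : Rˣ)) := by
  constructor
  · rw [show (g : R) * e * (g⁻¹ : Rˣ) * (g * f * (g⁻¹ : Rˣ)) = g * (e * f) * (g⁻¹ : Rˣ) by
      simp [mul_assoc], h.1]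
  · rw [show (g : R) * f * (g⁻¹ : Rˣ) * (g * e * (g⁻¹ : Rˣ)) = g * (f * e) * (g⁻¹ : Rˣ) by
      simp [mul_assoc], h.2]

theorem isIdempotentElem_unit_conj (g : Rˣ) {e : R} (he : IsIdempotentElem e) :
    IsIdempotentElem ((g : R) * e * (g⁻¹ : Rˣ)) := by
  rw [IsIdempotentElem, show (g : R) * e * (g⁻¹ : Rˣ) * (g * e * (g⁻¹ : Rˣ)) =
    g * (e * e) * (g⁻¹ : Rˣ) by simp [mul_assoc], he.eq]

/-- If `c e = f d` with units `c`, `d` and idempotents `e`, `f`, then `f` and `c e c⁻¹` absorb each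
other, and they are equal because idempotents commute. -/
theorem IsFactorizable.unit_conj_eq (hR : IsFactorizable R) {e f : R} (he : IsIdempotentElem e)
    (hf : IsIdempotentElem f) {c d : Rˣ} (h : (c : R) * e = f * d) :
    (c : R) * e * (c⁻¹ : Rˣ) = f := by
  have h₁ : f * ((c : R) * e * (c⁻¹ : Rˣ)) = (c : R) * e * (c⁻¹ : Rˣ) := by
    rw [h, ← mul_assoc, ← mul_assoc, hf.eq]
  have h₂ : (c : R) * e * (c⁻¹ : Rˣ) * f = f := by
    have : f = c * e * (d⁻¹ : Rˣ) := by rw [h, Units.mul_inv_cancel_right]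
    conv_lhs => rw [this]
    rw [show (c : R) * e * (c⁻¹ : Rˣ) * (c * e * (d⁻¹ : Rˣ)) = c * (e * e) * (d⁻¹ : Rˣ) by
      simp [mul_assoc], he.eq, ← this]
  rw [← h₁, hR.idem_comm _ _ hf (isIdempotentElem_unit_conj c he), h₂]

/-- A unit that fixes an idempotent on one side commutes with it. -/
theorem IsFactorizable.unit_mul_eq_of_mul_unit_eq (hR : IsFactorizable R) {e : R}
    (he : IsIdempotentElem e) {g : Rˣ} (h : e * g = e) : (g : R) * e = e := by
  have h' : e * (g⁻¹ : Rˣ) = e := by rw [Units.mul_inv_eq_iff_eq_mul, h]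
  have hc := hR.idem_comm _ _ he (isIdempotentElem_unit_conj g he)
  rwa [mul_assoc (g : R) e, h', ← mul_assoc, h, mul_assoc, he.eq, eq_comm] at hc

theorem IsFactorizable.exists_unit_conj_idemLE (hR : IsFactorizable R) {e f a b : R}
    (he : IsIdempotentElem e) (hf : IsIdempotentElem f) (h : e = a * f * b) :
    ∃ g : Rˣ, idemLE ((g : R) * e * (g⁻¹ : Rˣ)) f := by
  obtain ⟨g, i, hi, rfl⟩ := hR.eq_unit_mul_idem a
  obtain ⟨j, k, hj, rfl⟩ := hR.eq_idem_mul_unit b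
  have hif := (hR.mul_isMeet hi hf).1
  obtain ⟨hidem, hle, -⟩ := hR.mul_isMeet hif hj
  have hg : (g : R) * (i * f * j) * (g⁻¹ : Rˣ) = e := by
    refine hR.unit_conj_eq hidem he (d := k⁻¹) ?_
    rw [Units.eq_mul_inv_iff_mul_eq, h]
    simp only [mul_assoc]
  refine ⟨g⁻¹, ?_⟩
  rw [← hg, show ((g⁻¹ : Rˣ) : R) * (g * (i * f * j) * (g⁻¹ : Rˣ)) * ((g⁻¹)⁻¹ : Rˣ) = i * f * j by
    simp [mul_assoc]]
  exact idemLE_trans hle (hR.mul_isMeet hi hf).2.2.1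

/-- Conjugation by a unit of finite order cannot strictly decrease an idempotent. -/
theorem unit_conj_eq_of_idemLE [Finite Rˣ] {e : R} (he : IsIdempotentElem e) {g : Rˣ}
    (h : idemLE ((g : R) * e * (g⁻¹ : Rˣ)) e) : (g : R) * e * (g⁻¹ : Rˣ) = e := by
  have key : ∀ n : ℕ, idemLE (((g ^ (n + 1) : Rˣ) : R) * e * ((g ^ (n + 1))⁻¹ : Rˣ))
      ((g : R) * e * (g⁻¹ : Rˣ)) := fun n ↦ by
    induction n with
    | zero => simpa using idemLE_refl (isIdempotentElem_unit_conj g he)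
    | succ n ih =>
      have := idemLE_unit_conj g (idemLE_trans ih h)
      rw [pow_succ', mul_inv_rev, Units.val_mul, Units.val_mul]
      simpa only [mul_assoc] using this
  -- The conjugates by the powers of `g` descend and return to `e` at the order of `g`.
  have h1 := key (orderOf g - 1)
  rw [Nat.sub_add_cancel (orderOf_pos g), pow_orderOf_eq_one] at h1
  exact idemLE_antisymm h (by simpa using h1)

/-- In a factorizable monoid with finitely many units, `𝒥`-equivalent idempotents are
conjugate. -/
theorem IsFactorizable.exists_unit_conj_eq_of_greenJ [Finite Rˣ] (hR : IsFactorizable R) {e f : R}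
    (he : IsIdempotentElem e) (hf : IsIdempotentElem f) (h : greenJ e f) :
    ∃ g : Rˣ, (g : R) * e * (g⁻¹ : Rˣ) = f := by
  have h₁ : e ∈ {x : R | ∃ a b : R, x = a * f * b} := h ▸ ⟨1, 1, by simp⟩
  have h₂ : f ∈ {x : R | ∃ a b : R, x = a * e * b} := h.symm ▸ ⟨1, 1, by simp⟩
  obtain ⟨a, b, hab⟩ := h₁
  obtain ⟨c, d, hcd⟩ := h₂
  obtain ⟨g, hg⟩ := hR.exists_unit_conj_idemLE he hf hab
  obtain ⟨k, hk⟩ := hR.exists_unit_conj_idemLE hf he hcd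
  have hgk := idemLE_unit_conj g hk
  rw [show (g : R) * (k * f * (k⁻¹ : Rˣ)) * (g⁻¹ : Rˣ) =
    ((g * k : Rˣ) : R) * f * ((g * k)⁻¹ : Rˣ) by simp [mul_assoc]] at hgk
  rw [unit_conj_eq_of_idemLE hf (idemLE_trans hgk hg)] at hgk
  exact ⟨g, idemLE_antisymm hg hgk⟩

variable {B : Type*} {M : CoxeterMatrix B} (cs : CoxeterSystem M Rˣ)

/-! ### Type maps -/

theorem lowerType_subset_typeMap (e : R) : lowerType cs e ⊆ typeMap cs e := fun _ hi ↦ hi.1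

theorem upperType_subset_typeMap (e : R) : upperType cs e ⊆ typeMap cs e := fun _ hi ↦ hi.1

theorem simple_ne_of_mem_upperType_of_mem_lowerType (e : R) :
    ∀ i ∈ upperType cs e, ∀ j ∈ lowerType cs e, cs.simple i ≠ cs.simple j :=
  fun _ hi _ hj h ↦ hi.2 (h ▸ hj.2)

theorem lowerType_anti {e f : R} (h : idemLE e f) : lowerType cs f ⊆ lowerType cs e := by
  rintro i ⟨h₁, h₂⟩
  have he : e * (cs.simple i : R) = e := by rw [← h.1, mul_assoc, h₂]
  refine ⟨?_, he⟩
  rw [he, ← h.2, ← mul_assoc, h₁, h₂]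

theorem upper_mul_lower_mem_typeMap {e : R} {x : Rˣ} (hx : ∃ u ∈ cs.parabolic (upperType cs e),
    ∃ l ∈ cs.parabolic (lowerType cs e), x = u * l) : x ∈ cs.parabolic (typeMap cs e) := by
  obtain ⟨u, hu, l, hl, rfl⟩ := hx
  exact mul_mem (cs.parabolic_mono (upperType_subset_typeMap cs e) hu)
    (cs.parabolic_mono (lowerType_subset_typeMap cs e) hl)

namespace IsRennerCoxeterSystem

variable {cs} {Λ : Set R} (h : IsRennerCoxeterSystem cs Λ)
include h

theorem mem_parabolic_typeMap_iff {e : R} (he : e ∈ Λ) {w : Rˣ} :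
    w ∈ cs.parabolic (typeMap cs e) ↔ (w : R) * e = e * w := by
  rw [← SetLike.mem_coe, ← h.centralizer_eq cs he]
  rfl

theorem mem_parabolic_lowerType_iff {e : R} (he : e ∈ Λ) {w : Rˣ} :
    w ∈ cs.parabolic (lowerType cs e) ↔ e * w = e := by
  rw [← SetLike.mem_coe, ← h.fixer_eq cs he]
  refine ⟨fun hw ↦ hw.2, fun hw ↦ ⟨?_, hw⟩⟩
  rw [hw, h.factorizable.unit_mul_eq_of_mul_unit_eq (h.idem e he) hw]

theorem eq_of_unit_conj {e f : R} (he : e ∈ Λ) (hf : f ∈ Λ) {w : Rˣ}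
    (hw : (w : R) * e * (w⁻¹ : Rˣ) = f) : e = f :=
  (h.transversal e (h.idem e he)).unique ⟨he, 1, by simp⟩ ⟨hf, w, hw⟩

/-- `W_{λ^*(e)}` and `W_{λ_*(e)}` commute, because the fixer `W_{λ_*(e)}` of `e` is normalized by
the elements that commute with `e`. -/
theorem commute_upper_lower {e : R} (he : e ∈ Λ) {x y : Rˣ}
    (hx : x ∈ cs.parabolic (upperType cs e)) (hy : y ∈ cs.parabolic (lowerType cs e)) :
    x * y = y * x := by
  refine cs.commute_of_mem_parabolic (fun i hi j hj ↦ ?_) hx hy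
  refine cs.simple_commute_of_conj_mem (simple_ne_of_mem_upperType_of_mem_lowerType cs e) hi hj ?_
  rw [h.mem_parabolic_lowerType_iff he, Units.val_mul, Units.val_mul, ← mul_assoc, ← mul_assoc,
    ← hi.1, mul_assoc _ e, hj.2, hi.1, mul_assoc, ← Units.val_mul, cs.simple_mul_simple_self,
    Units.val_one, mul_one]

theorem exists_upper_mul_lower {e : R} (he : e ∈ Λ) {x : Rˣ}
    (hx : x ∈ cs.parabolic (typeMap cs e)) :
    ∃ u ∈ cs.parabolic (upperType cs e), ∃ l ∈ cs.parabolic (lowerType cs e), x = u * l := by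
  induction hx using Subgroup.closure_induction with
  | mem x hx =>
    obtain ⟨i, hi, rfl⟩ := hx
    by_cases hs : e * (cs.simple i : R) = e
    · exact ⟨1, one_mem _, _, cs.simple_mem_parabolic ⟨hi, hs⟩, (one_mul _).symm⟩
    · exact ⟨_, cs.simple_mem_parabolic ⟨hi, hs⟩, 1, one_mem _, (mul_one _).symm⟩
  | one => exact ⟨1, one_mem _, 1, one_mem _, (mul_one _).symm⟩
  | mul x y _ _ hx hy =>
    obtain ⟨u, hu, l, hl, rfl⟩ := hx
    obtain ⟨u', hu', l', hl', rfl⟩ := hy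
    refine ⟨_, MulMemClass.mul_mem hu hu', _, MulMemClass.mul_mem hl hl', ?_⟩
    rw [mul_assoc, ← mul_assoc l, ← h.commute_upper_lower he hu' hl]
    simp only [mul_assoc]
  | inv x _ hx =>
    obtain ⟨u, hu, l, hl, rfl⟩ := hx
    refine ⟨_, inv_mem hu, _, inv_mem hl, ?_⟩
    rw [mul_inv_rev, h.commute_upper_lower he (inv_mem hu) (inv_mem hl)]

/-- Two decompositions of an element through idempotents of `Λ` differ by units `c = a'⁻¹ a` and
`d = b' b⁻¹` that centralize the idempotent and agree modulo its fixer. -/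
theorem eq_and_mem_of_mul_eq_mul {e e' : R} (he : e ∈ Λ) (he' : e' ∈ Λ) {a b a' b' : Rˣ}
    (heq : (a : R) * e * b = a' * e' * b') :
    e = e' ∧ a'⁻¹ * a ∈ cs.parabolic (typeMap cs e) ∧ b' * b⁻¹ ∈ cs.parabolic (typeMap cs e) ∧
      (b' * b⁻¹) * (a'⁻¹ * a)⁻¹ ∈ cs.parabolic (lowerType cs e) := by
  have hcd : ((a'⁻¹ * a : Rˣ) : R) * e = e' * ((b' * b⁻¹ : Rˣ) : R) := by
    rw [Units.val_mul, Units.val_mul, mul_assoc, Units.inv_mul_eq_iff_eq_mul, ← mul_assoc,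
      ← mul_assoc, Units.eq_mul_inv_iff_mul_eq, heq]
  have hconj := h.factorizable.unit_conj_eq (h.idem e he) (h.idem e' he') hcd
  obtain rfl := h.eq_of_unit_conj he he' hconj
  have hc := Units.mul_inv_eq_iff_eq_mul _ |>.1 hconj
  have hlow : (b' * b⁻¹) * (a'⁻¹ * a)⁻¹ ∈ cs.parabolic (lowerType cs e) := by
    rw [h.mem_parabolic_lowerType_iff he, Units.val_mul _ (a'⁻¹ * a)⁻¹, ← mul_assoc, ← hcd, hconj]
  have hct := (h.mem_parabolic_typeMap_iff he).2 hc
  refine ⟨rfl, hct, ?_, hlow⟩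
  have := MulMemClass.mul_mem (cs.parabolic_mono (lowerType_subset_typeMap cs e) hlow) hct
  rwa [inv_mul_cancel_right] at this

theorem leftStandard_unique {r : R} {x e y x' e' y'} (h₁ : IsLeftStandard cs Λ r x e y)
    (h₂ : IsLeftStandard cs Λ r x' e' y') : x = x' ∧ e = e' ∧ y = y' := by
  obtain ⟨rfl, -, hd, hl⟩ := h.eq_and_mem_of_mul_eq_mul h₁.mem h₂.mem (h₁.eq.symm.trans h₂.eq)
  have hy : y' * y⁻¹ = 1 := cs.eq_one_of_mem_minReps' h₁.right_mem
    (by rw [inv_mul_cancel_right]; exact h₂.right_mem) hd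
  rw [hy, one_mul] at hl
  have hx : x'⁻¹ * x = 1 := cs.eq_one_of_mem_minReps h₂.left_mem
    (by rw [mul_inv_cancel_left]; exact h₁.left_mem) (inv_mem_iff.1 hl)
  exact ⟨(inv_mul_eq_one.1 hx).symm, rfl, (mul_inv_eq_one.1 hy).symm⟩

theorem rightStandard_unique {r : R} {y e x y' e' x'} (h₁ : IsRightStandard cs Λ r y e x)
    (h₂ : IsRightStandard cs Λ r y' e' x') : y = y' ∧ e = e' ∧ x = x' := by
  obtain ⟨rfl, hc, -, hl⟩ := h.eq_and_mem_of_mul_eq_mul h₁.mem h₂.mem (h₁.eq.symm.trans h₂.eq)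
  have hy : y'⁻¹ * y = 1 := cs.eq_one_of_mem_minReps h₂.left_mem
    (by rw [mul_inv_cancel_left]; exact h₁.left_mem) hc
  rw [hy, inv_one, mul_one] at hl
  have hx : x' * x⁻¹ = 1 := cs.eq_one_of_mem_minReps' h₁.right_mem
    (by rw [inv_mul_cancel_right]; exact h₂.right_mem) hl
  exact ⟨(inv_mul_eq_one.1 hy).symm, rfl, (mul_inv_eq_one.1 hx).symm⟩

theorem adherencePlus_iff {r s : R} {x e y a f b} (hr : IsLeftStandard cs Λ r x e y)
    (hs : IsLeftStandard cs Λ s a f b) :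
    adherencePlus cs Λ r s ↔ idemLE e f ∧
      ∃ w ∈ (cs.parabolic (upperType cs f) : Set Rˣ) * (cs.parabolic (lowerType cs e) : Set Rˣ),
        cs.bruhatLE x (a * w) ∧ cs.bruhatLE (w⁻¹ * b) y := by
  constructor
  · rintro ⟨x', e', y', a', f', b', hr', hs', hle⟩
    obtain ⟨rfl, rfl, rfl⟩ := h.leftStandard_unique hr hr'
    obtain ⟨rfl, rfl, rfl⟩ := h.leftStandard_unique hs hs'
    exact hle
  · exact fun hle ↦ ⟨x, e, y, a, f, b, hr, hs, hle⟩

theorem adherenceMinus_iff {r s : R} {y e x b f a} (hr : IsRightStandard cs Λ r y e x)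
    (hs : IsRightStandard cs Λ s b f a) :
    adherenceMinus cs Λ r s ↔ idemLE e f ∧
      ∃ w ∈ (cs.parabolic (lowerType cs e) : Set Rˣ) * (cs.parabolic (upperType cs f) : Set Rˣ),
        cs.bruhatLE x (w * a) ∧ cs.bruhatLE (b * w⁻¹) y := by
  constructor
  · rintro ⟨y', e', x', b', f', a', hr', hs', hle⟩
    obtain ⟨rfl, rfl, rfl⟩ := h.rightStandard_unique hr hr'
    obtain ⟨rfl, rfl, rfl⟩ := h.rightStandard_unique hs hs'
    exact hle
  · exact fun hle ↦ ⟨y, e, x, b, f, a, hr, hs, hle⟩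

end IsRennerCoxeterSystem

/-! ### The opposite cross-sectional lattice -/

section Finite

variable [Finite Rˣ]

/-- Conjugation `e ↦ w₀ e w₀` by the longest element, which is an involution. -/
noncomputable def longestConj (e : R) : R := (cs.longest : R) * e * (cs.longest : R)

theorem longest_mul_longest_mul (x : R) : (cs.longest : R) * ((cs.longest : R) * x) = x := by
  rw [← mul_assoc, ← Units.val_mul, cs.longest_mul_longest, Units.val_one, one_mul]

theorem longestConj_eq_unit_conj (e : R) :
    longestConj cs e = (cs.longest : R) * e * ((cs.longest⁻¹ : Rˣ) : R) := by
  rw [cs.longest_inv, longestConj]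

@[simp]
theorem longestConj_longestConj (e : R) : longestConj cs (longestConj cs e) = e := by
  rw [longestConj_eq_unit_conj, longestConj]
  simp [mul_assoc, longest_mul_longest_mul]

theorem longestConj_mul (e f : R) :
    longestConj cs (e * f) = longestConj cs e * longestConj cs f := by
  simp only [longestConj, mul_assoc, longest_mul_longest_mul]

theorem longestConj_inj {e f : R} : longestConj cs e = longestConj cs f ↔ e = f :=
  (Function.LeftInverse.injective (longestConj_longestConj cs)).eq_iff

theorem unit_mul_longestConj (w : Rˣ) (e : R) :
    (w : R) * longestConj cs e = longestConj cs ((cs.longest * w * cs.longest : Rˣ) * e) := by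
  simp only [longestConj, Units.val_mul, mul_assoc, longest_mul_longest_mul]

theorem longestConj_mul_unit (w : Rˣ) (e : R) :
    longestConj cs e * (w : R) = longestConj cs (e * (cs.longest * w * cs.longest : Rˣ)) := by
  have := cs.longest_mul_longest
  rw [Units.ext_iff, Units.val_mul, Units.val_one] at this
  simp only [longestConj, Units.val_mul, mul_assoc, this, mul_one]

theorem idemLE_longestConj_iff {e f : R} :
    idemLE (longestConj cs e) (longestConj cs f) ↔ idemLE e f := by
  simp only [idemLE, ← longestConj_mul, longestConj_inj]

theorem longest_conj_mem_parabolic_typeMap {e : R} {x : Rˣ}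
    (hx : x ∈ cs.parabolic (typeMap cs e)) :
    cs.longest * x * cs.longest ∈ cs.parabolic (typeMap cs (longestConj cs e)) := by
  refine cs.longest_conj_mem_parabolic (fun i hi ↦ ?_) hx
  obtain ⟨j, hj⟩ := cs.exists_simple_eq_longest_conj i
  refine ⟨j, ?_, hj⟩
  change (cs.simple j : R) * longestConj cs e = longestConj cs e * (cs.simple j : R)
  rw [← hj, unit_mul_longestConj, longestConj_mul_unit, cs.longest_conj_conj, hi]

theorem longest_conj_mem_parabolic_lowerType {e : R} {x : Rˣ}
    (hx : x ∈ cs.parabolic (lowerType cs e)) :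
    cs.longest * x * cs.longest ∈ cs.parabolic (lowerType cs (longestConj cs e)) := by
  refine cs.longest_conj_mem_parabolic (fun i hi ↦ ?_) hx
  obtain ⟨j, hj⟩ := cs.exists_simple_eq_longest_conj i
  refine ⟨j, ?_, hj⟩
  change (cs.simple j : R) * longestConj cs e = longestConj cs e * (cs.simple j : R) ∧
    longestConj cs e * (cs.simple j : R) = longestConj cs e
  rw [← hj, unit_mul_longestConj, longestConj_mul_unit, cs.longest_conj_conj, longestConj_inj,
    longestConj_inj]
  exact hi

theorem exists_upperType_longest_conj {e : R} {i : B} (hi : i ∈ upperType cs e) :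
    ∃ j ∈ upperType cs (longestConj cs e), cs.longest * cs.simple i * cs.longest = cs.simple j := by
  obtain ⟨j, hj⟩ := cs.exists_simple_eq_longest_conj i
  refine ⟨j, ?_, hj⟩
  change (cs.simple j : R) * longestConj cs e = longestConj cs e * (cs.simple j : R) ∧
    longestConj cs e * (cs.simple j : R) ≠ longestConj cs e
  rw [← hj, unit_mul_longestConj, longestConj_mul_unit, cs.longest_conj_conj, longestConj_inj,
    Ne, longestConj_inj]
  exact hi

theorem longest_conj_mem_parabolic_upperType {e : R} {x : Rˣ}
    (hx : x ∈ cs.parabolic (upperType cs e)) :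
    cs.longest * x * cs.longest ∈ cs.parabolic (upperType cs (longestConj cs e)) :=
  cs.longest_conj_mem_parabolic (fun _ hi ↦ exists_upperType_longest_conj cs hi) hx

variable {cs} in
theorem IsRennerCoxeterSystem.opposite {Λ : Set R} (h : IsRennerCoxeterSystem cs Λ) :
    IsRennerCoxeterSystem cs (opposite cs Λ) where
  factorizable := h.factorizable
  idem := by
    rintro _ ⟨e, he, rfl⟩
    have := isIdempotentElem_unit_conj cs.longest (h.idem e he)
    rwa [← longestConj_eq_unit_conj] at this
  transversal e he := by
    obtain ⟨f, ⟨hf, w, hw⟩, huniq⟩ := h.transversal e he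
    refine ⟨longestConj cs f, ⟨⟨f, hf, rfl⟩, cs.longest * w, ?_⟩, ?_⟩
    · rw [longestConj_eq_unit_conj, ← hw]
      simp [mul_assoc]
    · rintro _ ⟨⟨f', hf', rfl⟩, w', hw'⟩
      refine (longestConj_inj cs).2 (huniq f' ⟨hf', cs.longest * w', ?_⟩)
      rw [← longestConj_longestConj cs f', longestConj_eq_unit_conj]
      change (w' : R) * e * ((w'⁻¹ : Rˣ) : R) = longestConj cs f' at hw'
      rw [← hw']
      simp [mul_assoc]
  mul_mem := by
    rintro _ ⟨e, he, rfl⟩ _ ⟨f, hf, rfl⟩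
    exact ⟨e * f, h.mul_mem e he f hf, longestConj_mul cs e f⟩
  exists_conj_pair e e' he he' hle := by
    obtain ⟨w, f, hf, f', hf', hff', h₁, h₂⟩ := h.exists_conj_pair e e' he he' hle
    refine ⟨cs.longest * w, longestConj cs f, ⟨f, hf, rfl⟩, longestConj cs f', ⟨f', hf', rfl⟩,
      (idemLE_longestConj_iff cs).2 hff', ?_, ?_⟩
    · rw [longestConj_eq_unit_conj, ← h₁]
      simp [mul_assoc]
    · rw [longestConj_eq_unit_conj, ← h₂]
      simp [mul_assoc]
  upperType_mono := by
    rintro _ ⟨e, he, rfl⟩ _ ⟨f, hf, rfl⟩ hle i hi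
    have hle' := (idemLE_longestConj_iff cs).1 hle
    obtain ⟨j, hj, hij⟩ := exists_upperType_longest_conj cs hi
    change j ∈ upperType cs (longestConj cs (longestConj cs e)) at hj
    rw [longestConj_longestConj] at hj
    obtain ⟨k, hk, hjk⟩ := exists_upperType_longest_conj cs (h.upperType_mono e he f hf hle' hj)
    rw [← hij, cs.longest_conj_conj] at hjk
    rw [upperType, Set.mem_ofPred_eq, ← hjk] at hk
    exact hk
  centralizer_parabolic := by
    rintro _ ⟨e, he, rfl⟩
    refine ⟨typeMap cs (longestConj cs e), ?_⟩
    ext w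
    change (w : R) * longestConj cs e = longestConj cs e * w ↔
      w ∈ cs.parabolic (typeMap cs (longestConj cs e))
    rw [unit_mul_longestConj, longestConj_mul_unit, longestConj_inj,
      ← h.mem_parabolic_typeMap_iff he]
    refine ⟨fun hw ↦ ?_, fun hw ↦ ?_⟩
    · simpa [cs.longest_conj_conj] using longest_conj_mem_parabolic_typeMap cs hw
    · simpa using longest_conj_mem_parabolic_typeMap cs hw
  fixer_parabolic := by
    rintro _ ⟨e, he, rfl⟩
    refine ⟨lowerType cs (longestConj cs e), ?_⟩
    ext w
    change (w : R) * longestConj cs e = longestConj cs e * w ∧ longestConj cs e * w =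
      longestConj cs e ↔ w ∈ cs.parabolic (lowerType cs (longestConj cs e))
    rw [unit_mul_longestConj, longestConj_mul_unit, longestConj_inj, longestConj_inj]
    have hfix : cs.longest * w * cs.longest ∈ cs.parabolic (lowerType cs e) ↔ _ :=
      Set.ext_iff.1 (h.fixer_eq cs he).symm _
    refine hfix.symm.trans ⟨fun hw ↦ ?_, fun hw ↦ ?_⟩
    · simpa [cs.longest_conj_conj] using longest_conj_mem_parabolic_lowerType cs hw
    · simpa using longest_conj_mem_parabolic_lowerType cs hw

end Finite

/-! ### Vanilla forms -/

/-- If `w t (p q)` lies in `T = L U`, where `t ∈ U' L'`, `p ∈ U'`, `q ∈ L`, and `U'` and `L'`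
commute, then `w ∈ L U'`. -/
theorem mem_mul_of_mul_mul_mem {G : Type*} [Group G] {L U T L' U' : Subgroup G} (hL : L' ≤ L)
    (hU : U ≤ U') (hLT : L ≤ T) (hT : ∀ x ∈ T, ∃ u ∈ U, ∃ l ∈ L, x = u * l)
    (hc : ∀ u ∈ U', ∀ l ∈ L', u * l = l * u) {w t p : G}
    (ht : ∃ u ∈ U', ∃ l ∈ L', t = u * l) (hp : p ∈ (U' : Set G) * (L : Set G))
    (hw : w * (t * p) ∈ T) : w ∈ (L : Set G) * (U' : Set G) := by
  obtain ⟨a, ha, b, hb, rfl⟩ := ht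
  obtain ⟨p, hp, q, hq, rfl⟩ := hp
  rw [SetLike.mem_coe] at hp hq
  have hbq := mul_mem (hL hb) hq
  have he : a * b * (p * q) = a * p * (b * q) := by
    rw [mul_assoc a b, ← mul_assoc b p q, ← hc p hp b hb]
    simp only [mul_assoc]
  change w * (a * b * (p * q)) ∈ T at hw
  rw [he, ← mul_assoc] at hw
  have hwap : w * (a * p) ∈ T := by
    have := mul_mem hw (inv_mem (hLT hbq))
    rwa [mul_inv_cancel_right] at this
  obtain ⟨u, hu, l, hl, hul⟩ := hT _ (inv_mem hwap)
  refine ⟨l⁻¹, inv_mem hl, u⁻¹ * (a * p)⁻¹, mul_mem (inv_mem (hU hu)) (inv_mem (mul_mem ha hp)), ?_⟩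
  change l⁻¹ * (u⁻¹ * (a * p)⁻¹) = w
  rw [← mul_assoc, ← mul_inv_rev, ← hul, inv_inv, mul_inv_cancel_right]

section Vanilla

variable {cs} [Finite Rˣ] {Λ : Set R} {r : R} {σm : Rˣ} {em : R} {σ0 : Rˣ} {ep : R} {σp : Rˣ}

namespace IsVanilla

theorem minus_eq (h : IsRennerCoxeterSystem cs Λ) (hr : IsVanilla cs Λ r σm em σ0 ep σp) :
    em = longestConj cs ep := by
  obtain ⟨e, he, hem⟩ := hr.minus_mem
  change longestConj cs e = em at hem
  have hidem := h.opposite.idem em hr.minus_mem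
  obtain ⟨g, hg⟩ := h.factorizable.exists_unit_conj_eq_of_greenJ hidem (h.idem ep hr.plus_mem)
    (hr.minus_greenJ.trans hr.greenJ_plus)
  rw [← hem, ← h.eq_of_unit_conj he hr.plus_mem (w := g * cs.longest)]
  rw [← hg, ← hem, longestConj_eq_unit_conj]
  simp [mul_assoc]

/-- The middle factor is `b z w₀` with `b ∈ W_{λ^*(e₋)}` and `z` of maximal length in
`W_{λ_*(e₋)}`: since `e₋ = w₀ e₊ w₀`, the double coset that defines the middle factor is
`W_{λ_*(e₋)} w₀`, and right multiplication by `w₀` reverses lengths. -/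
theorem exists_middle_eq (h : IsRennerCoxeterSystem cs Λ)
    (hr : IsVanilla cs Λ r σm em σ0 ep σp) :
    ∃ b ∈ cs.parabolic (upperType cs em), ∃ z ∈ cs.parabolic (lowerType cs em),
      (∀ c ∈ cs.parabolic (lowerType cs em), cs.length c ≤ cs.length z) ∧
        σ0 = b * z * cs.longest := by
  have hem := hr.minus_eq h
  obtain ⟨m, ⟨hm, hmin⟩, hσ⟩ := hr.middle_mem
  obtain ⟨x, hx, y, hy, rfl⟩ := DoubleCoset.mem_doubleCoset.1 hm
  obtain ⟨_, ⟨u, hu, _, rfl, rfl⟩, v, hv, rfl⟩ := hσ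
  have hy' := longest_conj_mem_parabolic_lowerType cs hy
  have hv' := longest_conj_mem_parabolic_upperType cs hv
  rw [← hem] at hy' hv'
  have hz := mul_mem hx hy'
  refine ⟨_, mul_mem hu hv', _, hz, fun c hc ↦ ?_, ?_⟩
  · have hle := (hmin (c * cs.longest)
      (DoubleCoset.mem_doubleCoset.2 ⟨c, hc, 1, one_mem _, (mul_one _).symm⟩)).length_le
    have h₁ := cs.length_mul_longest_add c
    have h₂ := cs.length_mul_longest_add (x * (cs.longest * y * cs.longest))
    rw [show x * (cs.longest * y * cs.longest) * cs.longest = x * cs.longest * y by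
      simp only [mul_assoc, cs.longest_mul_longest, mul_one]] at h₂
    omega
  · rw [mul_assoc u, h.opposite.commute_upper_lower hr.minus_mem hv' hz]
    simp only [mul_assoc, cs.longest_mul_longest, mul_one,
      cs.longest_mul_cancel_left]

theorem middle_mul_longest_mem (h : IsRennerCoxeterSystem cs Λ)
    (hr : IsVanilla cs Λ r σm em σ0 ep σp) : ∃ u ∈ cs.parabolic (upperType cs em),
      ∃ l ∈ cs.parabolic (lowerType cs em), σ0 * cs.longest = u * l := by
  obtain ⟨b, hb, z, hz, -, rfl⟩ := hr.exists_middle_eq h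
  exact ⟨b, hb, z, hz, by rw [mul_assoc _ cs.longest, cs.longest_mul_longest, mul_one]⟩

/-- The mirror image of `IsVanilla.exists_middle_eq`, for the inverse of the middle factor. -/
theorem exists_middle_inv_eq (h : IsRennerCoxeterSystem cs Λ)
    (hr : IsVanilla cs Λ r σm em σ0 ep σp) :
    ∃ b ∈ cs.parabolic (upperType cs ep), ∃ z ∈ cs.parabolic (lowerType cs ep),
      (∀ c ∈ cs.parabolic (lowerType cs ep), cs.length c ≤ cs.length z) ∧
        σ0⁻¹ = b * z * cs.longest := by
  have hem := hr.minus_eq h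
  obtain ⟨b, hb, z, hz, hmax, rfl⟩ := hr.exists_middle_eq h
  have hb' := longest_conj_mem_parabolic_upperType cs (inv_mem hb)
  have hz' := longest_conj_mem_parabolic_lowerType cs (inv_mem hz)
  rw [hem, longestConj_longestConj] at hb' hz'
  refine ⟨_, hb', _, hz', fun c hc ↦ ?_, ?_⟩
  · have := longest_conj_mem_parabolic_lowerType cs hc
    rw [← hem] at this
    simpa [cs.length_longest_conj] using hmax _ this
  · rw [h.opposite.commute_upper_lower hr.minus_mem hb hz]
    simp only [mul_inv_rev, cs.longest_inv, mul_assoc, cs.longest_mul_longest, mul_one,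
      cs.longest_mul_cancel_left]

theorem inv_middle_mul_longest_mem (h : IsRennerCoxeterSystem cs Λ)
    (hr : IsVanilla cs Λ r σm em σ0 ep σp) : ∃ u ∈ cs.parabolic (upperType cs ep),
      ∃ l ∈ cs.parabolic (lowerType cs ep), σ0⁻¹ * cs.longest = u * l := by
  obtain ⟨b, hb, z, hz, -, he⟩ := hr.exists_middle_inv_eq h
  exact ⟨b, hb, z, hz, by rw [he, mul_assoc _ cs.longest, cs.longest_mul_longest, mul_one]⟩

/-- The middle factor carries `e₊` to `e₋`. -/
theorem minus_mul_middle (h : IsRennerCoxeterSystem cs Λ)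
    (hr : IsVanilla cs Λ r σm em σ0 ep σp) : em * (σ0 : R) = σ0 * ep := by
  have hc := (h.opposite.mem_parabolic_typeMap_iff hr.minus_mem).1
    (upper_mul_lower_mem_typeMap cs (hr.middle_mul_longest_mem h))
  have hw := cs.longest_mul_longest
  rw [Units.ext_iff, Units.val_mul, Units.val_one] at hw
  have hep : (cs.longest : R) * em = ep * cs.longest := by
    rw [hr.minus_eq h, longestConj]
    simp only [mul_assoc, longest_mul_longest_mul]
  rw [Units.val_mul, mul_assoc, hep] at hc
  calc em * (σ0 : R) = em * ((σ0 : R) * cs.longest) * cs.longest := by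
        simp only [mul_assoc, hw, mul_one]
    _ = σ0 * ep := by rw [← hc]; simp only [mul_assoc, hw, mul_one]

theorem isLeftStandard (h : IsRennerCoxeterSystem cs Λ)
    (hr : IsVanilla cs Λ r σm em σ0 ep σp) : IsLeftStandard cs Λ r (σm * σ0) ep σp where
  eq := by
    rw [hr.eq, mul_assoc (σm : R), hr.minus_mul_middle h, ← mul_assoc, mul_assoc _ ep ep,
      (h.idem ep hr.plus_mem).eq, Units.val_mul]
  mem := hr.plus_mem
  left_mem := by
    obtain ⟨b, hb, z, hz, hmax, rfl⟩ := hr.exists_middle_eq h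
    refine cs.mul_mem_minReps_of_longest (simple_ne_of_mem_upperType_of_mem_lowerType cs em)
      (cs.parabolic_mono (upperType_subset_typeMap cs em))
      (cs.parabolic_mono (lowerType_subset_typeMap cs em)) (fun c hc ↦ ?_) hr.left_mem hb hz hmax
    rw [hr.minus_eq h]
    exact longest_conj_mem_parabolic_lowerType cs hc
  right_mem := hr.right_mem

theorem isRightStandard (h : IsRennerCoxeterSystem cs Λ)
    (hr : IsVanilla cs Λ r σm em σ0 ep σp) :
    IsRightStandard cs (opposite cs Λ) r σm em (σ0 * σp) where
  eq := by
    rw [hr.eq, mul_assoc _ (σ0 : R), ← hr.minus_mul_middle h, ← mul_assoc, mul_assoc _ em em,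
      (h.opposite.idem em hr.minus_mem).eq, Units.val_mul, ← mul_assoc]
  mem := hr.minus_mem
  right_mem := by
    obtain ⟨b, hb, z, hz, hmax, he⟩ := hr.exists_middle_inv_eq h
    rw [← cs.inv_mem_minReps_iff, mul_inv_rev, he]
    refine cs.mul_mem_minReps_of_longest (simple_ne_of_mem_upperType_of_mem_lowerType cs ep)
      (cs.parabolic_mono (upperType_subset_typeMap cs ep))
      (cs.parabolic_mono (lowerType_subset_typeMap cs ep)) (fun c hc ↦ ?_)
      (cs.inv_mem_minReps_iff.2 hr.right_mem) hb hz hmax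
    have := longest_conj_mem_parabolic_lowerType cs hc
    rwa [hr.minus_eq h, longestConj_longestConj] at this
  left_mem := hr.left_mem

variable {s : R} {τm : Rˣ} {fm : R} {τ0 : Rˣ} {fp : R} {τp : Rˣ}

/-- For fixed `w₊`, the first two inequalities between the factors of the vanilla forms amount to
one inequality between the left factors of the left standard forms. -/
theorem left_bruhatLE_iff (h : IsRennerCoxeterSystem cs Λ) (hr : IsVanilla cs Λ r σm em σ0 ep σp)
    (hs : IsVanilla cs Λ s τm fm τ0 fp τp) (hle : idemLE em fm) {wp : Rˣ}
    (hwp : wp ∈ (cs.parabolic (upperType cs fp) : Set Rˣ) *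
      (cs.parabolic (lowerType cs ep) : Set Rˣ)) :
    cs.bruhatLE (σm * σ0) (τm * τ0 * wp) ↔
      ∃ wm ∈ (cs.parabolic (lowerType cs em) : Set Rˣ) *
          (cs.parabolic (upperType cs fm) : Set Rˣ),
        cs.bruhatLE (τm * wm⁻¹) σm ∧ cs.bruhatLE σ0 (wm * τ0 * wp) := by
  have hσ := upper_mul_lower_mem_typeMap cs (hr.middle_mul_longest_mem h)
  rw [mul_assoc τm]
  constructor
  · intro hσσ
    obtain ⟨w, hw, h₁, h₂⟩ := cs.exists_of_mul_bruhatLE_mul hr.left_mem hσ hσσ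
    refine ⟨w, ?_, h₁, by rwa [mul_assoc]⟩
    have hwp' : cs.longest * wp * cs.longest ∈
        (cs.parabolic (upperType cs fm) : Set Rˣ) * (cs.parabolic (lowerType cs em) : Set Rˣ) := by
      obtain ⟨a, ha, b, hb, rfl⟩ := hwp
      rw [hr.minus_eq h, hs.minus_eq h]
      refine ⟨_, longest_conj_mem_parabolic_upperType cs ha, _,
        longest_conj_mem_parabolic_lowerType cs hb, ?_⟩
      simp only [mul_assoc, cs.longest_mul_cancel_left]
    refine mem_mul_of_mul_mul_mem (cs.parabolic_mono (lowerType_anti cs hle))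
      (cs.parabolic_mono (h.opposite.upperType_mono em hr.minus_mem fm hs.minus_mem hle))
      (cs.parabolic_mono (lowerType_subset_typeMap cs em))
      (fun x ↦ h.opposite.exists_upper_mul_lower hr.minus_mem)
      (fun u hu l hl ↦ h.opposite.commute_upper_lower hs.minus_mem hu hl)
      (hs.middle_mul_longest_mem h) hwp' ?_
    simpa only [mul_assoc, cs.longest_mul_cancel_left] using hw
  · rintro ⟨w, -, h₁, h₂⟩
    rw [mul_assoc w] at h₂
    exact cs.mul_bruhatLE_mul_of_bruhatLE hr.left_mem hσ h₁ h₂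

/-- The mirror image of `IsVanilla.left_bruhatLE_iff`, obtained from the same comparison lemmas for
the inverses. -/
theorem right_bruhatLE_iff (h : IsRennerCoxeterSystem cs Λ) (hr : IsVanilla cs Λ r σm em σ0 ep σp)
    (hs : IsVanilla cs Λ s τm fm τ0 fp τp) (hle : idemLE ep fp) {wm : Rˣ}
    (hwm : wm ∈ (cs.parabolic (lowerType cs em) : Set Rˣ) *
      (cs.parabolic (upperType cs fm) : Set Rˣ)) :
    cs.bruhatLE (σ0 * σp) (wm * (τ0 * τp)) ↔
      ∃ wp ∈ (cs.parabolic (upperType cs fp) : Set Rˣ) *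
          (cs.parabolic (lowerType cs ep) : Set Rˣ),
        cs.bruhatLE σ0 (wm * τ0 * wp) ∧ cs.bruhatLE (wp⁻¹ * τp) σp := by
  have hσ := upper_mul_lower_mem_typeMap cs (hr.inv_middle_mul_longest_mem h)
  have hσp := cs.inv_mem_minReps_iff.2 hr.right_mem
  rw [← cs.bruhatLE_inv_iff, show (wm * (τ0 * τp))⁻¹ = τp⁻¹ * (τ0⁻¹ * wm⁻¹) by group, mul_inv_rev]
  constructor
  · intro hσσ
    obtain ⟨w, hw, h₁, h₂⟩ := cs.exists_of_mul_bruhatLE_mul hσp hσ hσσ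
    refine ⟨w⁻¹, ?_, ?_, ?_⟩
    · have hwm' : cs.longest * wm⁻¹ * cs.longest ∈
          (cs.parabolic (upperType cs fp) : Set Rˣ) *
            (cs.parabolic (lowerType cs ep) : Set Rˣ) := by
        obtain ⟨b, hb, a, ha, rfl⟩ := hwm
        have ha' := longest_conj_mem_parabolic_upperType cs (inv_mem ha)
        have hb' := longest_conj_mem_parabolic_lowerType cs (inv_mem hb)
        rw [hs.minus_eq h, longestConj_longestConj] at ha'
        rw [hr.minus_eq h, longestConj_longestConj] at hb'
        refine ⟨_, ha', _, hb', ?_⟩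
        simp only [mul_inv_rev, mul_assoc, cs.longest_mul_cancel_left]
      obtain ⟨l, hl, u, hu, rfl⟩ := mem_mul_of_mul_mul_mem (w := w)
        (cs.parabolic_mono (lowerType_anti cs hle))
        (cs.parabolic_mono (h.upperType_mono ep hr.plus_mem fp hs.plus_mem hle))
        (cs.parabolic_mono (lowerType_subset_typeMap cs ep))
        (fun x ↦ h.exists_upper_mul_lower hr.plus_mem)
        (fun u hu l hl ↦ h.commute_upper_lower hs.plus_mem hu hl)
        (hs.inv_middle_mul_longest_mem h) hwm'
        (by simpa only [mul_assoc, cs.longest_mul_cancel_left] using hw)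
      exact ⟨u⁻¹, inv_mem hu, l⁻¹, inv_mem hl, (mul_inv_rev l u).symm⟩
    · rw [← cs.bruhatLE_inv_iff]
      simpa only [mul_inv_rev, inv_inv] using h₂
    · rw [← cs.bruhatLE_inv_iff]
      simpa only [mul_inv_rev, inv_inv] using h₁
  · rintro ⟨w, -, h₁, h₂⟩
    refine cs.mul_bruhatLE_mul_of_bruhatLE (w := w⁻¹) hσp hσ ?_ ?_
    · simpa only [mul_inv_rev, inv_inv] using h₂.inv
    · simpa only [mul_inv_rev, inv_inv] using h₁.inv

end IsVanilla

end Vanilla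

end RennerCoxeter

theorem mainTheorem2 {R : Type*} [Monoid R] [Finite R] {B : Type*} {M : CoxeterMatrix B}
    (cs : CoxeterSystem M Rˣ) (Λ : Set R) (hΛ : RennerCoxeter.IsRennerCoxeterSystem cs Λ)
    (r s : R)
    (σm : Rˣ) (em : R) (σ0 : Rˣ) (ep : R) (σp : Rˣ)
    (hr : RennerCoxeter.IsVanilla cs Λ r σm em σ0 ep σp)
    (τm : Rˣ) (fm : R) (τ0 : Rˣ) (fp : R) (τp : Rˣ)
    (hs : RennerCoxeter.IsVanilla cs Λ s τm fm τ0 fp τp) :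
    List.TFAE [
      RennerCoxeter.idemLE em fm ∧ RennerCoxeter.idemLE ep fp ∧
        ∃ wm ∈ (cs.parabolic (RennerCoxeter.lowerType cs em) : Set Rˣ) *
            (cs.parabolic (RennerCoxeter.upperType cs fm) : Set Rˣ),
          ∃ wp ∈ (cs.parabolic (RennerCoxeter.upperType cs fp) : Set Rˣ) *
              (cs.parabolic (RennerCoxeter.lowerType cs ep) : Set Rˣ),
            cs.bruhatLE (τm * wm⁻¹) σm ∧ cs.bruhatLE σ0 (wm * τ0 * wp) ∧
              cs.bruhatLE (wp⁻¹ * τp) σp,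
      RennerCoxeter.adherencePlus cs Λ r s,
      RennerCoxeter.adherenceMinus cs (RennerCoxeter.opposite cs Λ) r s] := by
  have hm : RennerCoxeter.idemLE em fm ↔ RennerCoxeter.idemLE ep fp := by
    rw [hr.minus_eq hΛ, hs.minus_eq hΛ, RennerCoxeter.idemLE_longestConj_iff]
  rw [hΛ.adherencePlus_iff (hr.isLeftStandard hΛ) (hs.isLeftStandard hΛ),
    hΛ.opposite.adherenceMinus_iff (hr.isRightStandard hΛ) (hs.isRightStandard hΛ)]
  tfae_have 1 ↔ 2 := by
    constructor
    · rintro ⟨hle, hle', wm, hwm, wp, hwp, h₁, h₂, h₃⟩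
      exact ⟨hle', wp, hwp, (hr.left_bruhatLE_iff hΛ hs hle hwp).2 ⟨wm, hwm, h₁, h₂⟩, h₃⟩
    · rintro ⟨hle', wp, hwp, h, h₃⟩
      have hle := hm.2 hle'
      obtain ⟨wm, hwm, h₁, h₂⟩ := (hr.left_bruhatLE_iff hΛ hs hle hwp).1 h
      exact ⟨hle, hle', wm, hwm, wp, hwp, h₁, h₂, h₃⟩
  tfae_have 1 ↔ 3 := by
    constructor
    · rintro ⟨hle, hle', wm, hwm, wp, hwp, h₁, h₂, h₃⟩
      exact ⟨hle, wm, hwm, (hr.right_bruhatLE_iff hΛ hs hle' hwm).2 ⟨wp, hwp, h₂, h₃⟩, h₁⟩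
    · rintro ⟨hle, wm, hwm, h, h₁⟩
      have hle' := hm.1 hle
      obtain ⟨wp, hwp, h₂, h₃⟩ := (hr.right_bruhatLE_iff hΛ hs hle' hwm).1 h
      exact ⟨hle, hle', wm, hwm, wp, hwp, h₁, h₂, h₃⟩
  tfae_finish
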